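/- Let $\varepsilon_0,p_0,K_0,\varepsilon_1,p_1,K_1>0$, $M\ge 1$ and $\alpha>0$. Then there exists a constant $C>0$, depending only on $\varepsilon_0,p_0,K_0,M,\varepsilon_1,p_1,K_1$ and $\alpha$, such that the following holds for every $n$. Let $\xi,\zeta,\psi$ be real random variables such that $$\mathbb P(|\xi-\xi'|\le\varepsilon_0)\le 1-p_0,\quad \mathbb P(|\xi|>K_0)\le \tfrac{p_0}{4},\qquad \mathbb P(|\psi-\psi'|\le\varepsilon_1)\le 1-p_1,\quad \mathbb P(|\psi|>K_1)\le \tfrac{p_1}{4},$$ where $\xi'$ and $\psi'$ are independent copies of $\xi$ and $\psi$; no assumption is made on $\zeta$. Let $W=(w_{ij})$ be an $n\times n$ Wigner matrix with atom variables $\xi$ and $\zeta$, that is, a random real symmetric matrix whose entries $w_{ij}$, $i\le j$, are independent, with $w_{ij}$ distributed as $\xi$ for $i<j$ and $w_{ii}$ distributed as $\zeta$. Suppose that the event $\mathcal B_{W,M}=\{\|W\|\le M\sqrt n\}$, where $\|\cdot\|$ is the spectral norm, has probability at least $1/2$. Let $b$ be a random vector in $\mathbb R^n$, independent of $W$, whose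 coordinates are iid copies of $\psi$. Then every (random) unit eigenvector $v$ of $W$ that is independent of $b$ (for instance, any unit eigenvector that is a measurable function of $W$) satisfies $$\mathbb P\left(v^{\mathrm T}b=0 \,\middle|\, \mathcal B_{W,M}\right)\le C n^{-\alpha}.$$ -/

import Mathlib

open MeasureTheory ProbabilityTheory

/-- Quantitative non-degeneracy of a real random variable `X` on `(Ω, P)` with parameters
`ε, p, K`: `ℙ(|X - X'| ≤ ε) ≤ 1 - p` and `ℙ(|X| > K) ≤ p / 4`, where `X'` is an independent copy
of `X`. The independent pair `(X, X')` is realised on the product space as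
`(X ω.1, X ω.2)`. -/
structure IsNondegenerateWith {Ω : Type*} [MeasurableSpace Ω] (P : Measure Ω) (X : Ω → ℝ)
    (ε p K : ℝ) : Prop where
  antiConcentration : (P.prod P).real {ω : Ω × Ω | |X ω.1 - X ω.2| ≤ ε} ≤ 1 - p
  tail : P.real {ω | K < |X ω|} ≤ p / 4

/-- `W` is an `n × n` real symmetric Wigner matrix on `(Ω, P)` with atom variables `ξ` and `ζ`,
which are real random variables on `(Ω₀, P₀)`. -/
structure IsWigner {Ω Ω₀ : Type*} [MeasurableSpace Ω] [MeasurableSpace Ω₀]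
    (P : Measure Ω) (P₀ : Measure Ω₀) {n : ℕ} (W : Ω → Matrix (Fin n) (Fin n) ℝ)
    (ξ ζ : Ω₀ → ℝ) : Prop where
  measurable : ∀ i j, Measurable fun ω => W ω i j
  symm : ∀ ω, (W ω).IsSymm
  indep : iIndepFun (fun (e : {e : Fin n × Fin n // e.1 ≤ e.2}) ω => W ω e.1.1 e.1.2) P
  offDiag : ∀ i j, i < j → IdentDistrib (fun ω => W ω i j) ξ P P₀
  diag : ∀ i, IdentDistrib (fun ω => W ω i i) ζ P P₀

/-- The coordinates of the random vector `b` on `(Ω, P)` are iid copies of the random variable `ψ`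
on `(Ω₀, P₀)`. -/
structure IsIIDVector {Ω Ω₀ : Type*} [MeasurableSpace Ω] [MeasurableSpace Ω₀]
    (P : Measure Ω) (P₀ : Measure Ω₀) {n : ℕ} (b : Ω → EuclideanSpace ℝ (Fin n))
    (ψ : Ω₀ → ℝ) : Prop where
  measurable : Measurable b
  indep : iIndepFun (fun i ω => b ω i) P
  identDistrib : ∀ i, IdentDistrib (fun ω => b ω i) ψ P P₀

/-- The event `‖W‖ ≤ M √n`, where `‖W‖` is the spectral norm, i.e. the operator norm with respect
to the Euclidean norm on `ℝⁿ`. -/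
def normEvent {Ω : Type*} {n : ℕ} (W : Ω → Matrix (Fin n) (Fin n) ℝ) (M : ℝ) : Set Ω :=
  {ω | ‖Matrix.toEuclideanCLM (n := Fin n) (𝕜 := ℝ) (W ω)‖ ≤ M * √(n : ℝ)}

/-- The random vector `v` is almost surely a unit eigenvector of the random matrix `W`. -/
def IsUnitEigenvector {Ω : Type*} [MeasurableSpace Ω] (P : Measure Ω) {n : ℕ}
    (W : Ω → Matrix (Fin n) (Fin n) ℝ) (v : Ω → EuclideanSpace ℝ (Fin n)) : Prop :=
  ∀ᵐ ω ∂P, ‖v ω‖ = 1 ∧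
    ∃ lam : ℝ, Module.End.HasEigenvector (Matrix.toEuclideanLin (W ω)) lam (v ω)

/-!
The argument is a least-common-denominator argument in the style of Rudelson and Vershynin.

If `P (⟪y, b⟫ = 0)` exceeds `n ^ (-α)` for a fixed unit vector `y`, then every subvector of `y` is
arithmetically structured: for every set `I` of coordinates some dilate `θ • y` with `θ ≤ n ^ A` is
close to the integer lattice on `I`. This follows from a Gaussian form of Esseen's inequality:
the expectation of `exp (-Y ^ 2 / 2)` for an independent sum `Y` is at most a Gaussian average of
the moduli of the characteristic functions (`integral_prod_exp_neg_sq_le`), and these decay away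
from lattice points (`prod_norm_charFun_le`, `gaussAvg_le_of_farFromLattice`). As `v` is
independent of `b`, it remains to show that on `‖W‖ ≤ M √n` such structured eigenvectors of `W`
occur with probability at most `n ^ (-α)` (`exists_measureReal_structured_eigenvector_le`).

This is a union bound over a discretisation (`measureReal_exists_eigenvector_le`) against the
small-ball bound `IsWigner.measureReal_sum_sq_le` for `W y - μ y` with `y` and `μ` fixed. In the
latter, the symmetry of `W` is dealt with by choosing a set `I` of columns and using only the rows
outside `I`; each of the `n - |I|` rows contributes a factor `gaussAvg` that depends only on the
restriction of `y` to `I`.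

* Vectors with few coordinates of the typical size `1 / √n` admit a net with a small exponential
  growth rate, which a constant gain per row beats
  (`exists_measureReal_sparse_eigenvector_le`).
* All other vectors have proportionally many coordinates of order `1 / √n`; these are split into `k`
  blocks of size `m`, with `k` constant. Let `D` be the last level at which some block is far from
  the lattice. A row then gains a factor of order `κ / D`, for a total of about
  `(κ / D) ^ (n - m)`, while all blocks are within `κ / D` of rational vectors with denominators of
  order at most `D`, and the number of those is about `D ^ n / √n ^ (k * m)`
  (`card_rationalCode_le`). With `κ` a small power of `n` and `k` large compared with `A`, the factor
  `√n ^ (k * m)` outweighs the loss `κ ^ n * D ^ m` (`eventually_count_le`).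
-/

open Filter

/-! ### Gaussian averages of characteristic functions -/

lemma exp_neg_sq_half_eq_integral (y : ℝ) :
    ((Real.exp (-y ^ 2 / 2) : ℝ) : ℂ) =
      ∫ t, Complex.exp ((t * y : ℝ) * Complex.I) ∂(gaussianReal 0 1) := by
  have h := charFun_gaussianReal (μ := 0) (v := 1) y
  rw [charFun_apply_real] at h
  have e : (∫ t, Complex.exp ((t * y : ℝ) * Complex.I) ∂(gaussianReal 0 1)) =
      ∫ x : ℝ, Complex.exp (y * x * Complex.I) ∂(gaussianReal 0 1) := by
    congr 1; ext t; push_cast; ring_nf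
  rw [e, h]
  push_cast
  congr 1
  simp
  ring

/-- If `X e` are independent, then the Gaussian weight of a vector of affine forms in the `X e` is at
most a Gaussian average of the moduli of the characteristic functions of the `X e`. The affine
parts only contribute unimodular factors, and repeated use of the same `X e` in several forms is
harmless. -/
theorem integral_prod_exp_neg_sq_le {Ω : Type*} [MeasurableSpace Ω] (P : Measure Ω)
    [IsProbabilityMeasure P] {E J : Type*} [Fintype E] [Fintype J] (X : E → Ω → ℝ)
    (hX : ∀ e, Measurable (X e)) (hind : iIndepFun X P) (A : J → E → ℝ) (u : J → ℝ) :
    ∫ ω, ∏ j, Real.exp (-(∑ e, A j e * X e ω + u j) ^ 2 / 2) ∂P ≤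
      ∫ t : J → ℝ, ∏ e, ‖charFun (P.map (X e)) (∑ j, t j * A j e)‖
        ∂(Measure.pi fun _ => gaussianReal 0 1) := by
  set Γ : Measure (J → ℝ) := Measure.pi fun _ => gaussianReal 0 1 with hΓ
  have h1 : ((∫ ω, ∏ j, Real.exp (-(∑ e, A j e * X e ω + u j) ^ 2 / 2) ∂P : ℝ) : ℂ) =
      ∫ ω, ∫ t : J → ℝ,
        Complex.exp (((∑ j, t j * (∑ e, A j e * X e ω + u j) : ℝ) : ℂ) * Complex.I) ∂Γ ∂P := by
    rw [← integral_complex_ofReal]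
    congr 1; ext ω
    push_cast [exp_neg_sq_half_eq_integral]
    have := integral_fintype_prod_eq_prod (ι := J) (𝕜 := ℂ) (μ := fun _ => gaussianReal 0 1)
      (fun j (t : ℝ) => Complex.exp ((t * (∑ e, A j e * X e ω + u j) : ℝ) * Complex.I))
    rw [show (∏ j, Complex.exp (-(∑ e, (A j e : ℂ) * X e ω + u j) ^ 2 / 2)) =
      ∏ j, ∫ t, Complex.exp ((t * (∑ e, A j e * X e ω + u j) : ℝ) * Complex.I) ∂(gaussianReal 0 1)
      from Finset.prod_congr rfl fun j _ => by
        rw [← exp_neg_sq_half_eq_integral]; push_cast; rfl]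
    rw [← this]
    congr 1; ext t
    rw [← Complex.exp_sum]
    push_cast
    rw [Finset.sum_mul]
  have hmeas : Measurable (fun z : Ω × (J → ℝ) =>
      Complex.exp (((∑ j, z.2 j * (∑ e, A j e * X e z.1 + u j) : ℝ) : ℂ) * Complex.I)) := by
    have : Measurable (fun z : Ω × (J → ℝ) =>
      ((∑ j, z.2 j * (∑ e, A j e * X e z.1 + u j) : ℝ))) := by fun_prop
    fun_prop
  have hint : Integrable (Function.uncurry fun ω (t : J → ℝ) =>
      Complex.exp (((∑ j, t j * (∑ e, A j e * X e ω + u j) : ℝ) : ℂ) * Complex.I)) (P.prod Γ) := by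
    refine Integrable.of_bound (C := 1) hmeas.aestronglyMeasurable ?_
    exact Filter.Eventually.of_forall fun z => by
      simp only [Function.uncurry]; rw [Complex.norm_exp_ofReal_mul_I]
  have h2 : ∀ t : J → ℝ, ‖∫ ω,
      Complex.exp (((∑ j, t j * (∑ e, A j e * X e ω + u j) : ℝ) : ℂ) * Complex.I) ∂P‖ =
      ∏ e, ‖charFun (P.map (X e)) (∑ j, t j * A j e)‖ := by
    intro t
    have e1 : ∀ ω, Complex.exp (((∑ j, t j * (∑ e, A j e * X e ω + u j) : ℝ) : ℂ) * Complex.I) =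
        Complex.exp (((∑ j, t j * u j : ℝ) : ℂ) * Complex.I) *
        ∏ e, Complex.exp (((∑ j, t j * A j e : ℝ) : ℂ) * (X e ω : ℂ) * Complex.I) := by
      intro ω
      rw [← Complex.exp_sum, ← Complex.exp_add]
      congr 1
      have : (∑ j, t j * (∑ e, A j e * X e ω + u j) : ℝ) =
        (∑ j, t j * u j) + ∑ e, (∑ j, t j * A j e) * X e ω := by
        simp_rw [mul_add, Finset.sum_add_distrib, Finset.mul_sum, Finset.sum_mul]
        rw [Finset.sum_comm, add_comm]
        congr 1
        refine Finset.sum_congr rfl fun e _ => Finset.sum_congr rfl fun j _ => by ring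
      rw [this]
      push_cast
      rw [add_mul, Finset.sum_mul (Finset.univ : Finset E)]
    simp_rw [e1]
    rw [integral_const_mul, norm_mul, Complex.norm_exp_ofReal_mul_I, one_mul]
    have hi : iIndepFun (fun e ω =>
        Complex.exp (((∑ j, t j * A j e : ℝ) : ℂ) * (X e ω : ℂ) * Complex.I)) P :=
      hind.comp (fun e x => Complex.exp (((∑ j, t j * A j e : ℝ) : ℂ) * (x : ℂ) * Complex.I))
        (fun e => by fun_prop)
    rw [hi.integral_fun_prod_eq_prod_integral (fun e => by
      have := hX e
      exact Measurable.aestronglyMeasurable (by fun_prop)), norm_prod]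
    refine Finset.prod_congr rfl fun e _ => ?_
    rw [charFun_apply_real, integral_map (hX e).aemeasurable
      (Measurable.aestronglyMeasurable (by fun_prop))]
  have h3 : ((∫ ω, ∏ j, Real.exp (-(∑ e, A j e * X e ω + u j) ^ 2 / 2) ∂P : ℝ)) ≤
      ‖((∫ ω, ∏ j, Real.exp (-(∑ e, A j e * X e ω + u j) ^ 2 / 2) ∂P : ℝ) : ℂ)‖ := by
    rw [Complex.norm_real]; exact le_abs_self _
  refine h3.trans ?_
  rw [h1, integral_integral_swap hint]
  refine (norm_integral_le_integral_norm _).trans (le_of_eq ?_)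
  congr 1; ext t; exact h2 t

/-! ### Decay of characteristic functions -/

lemma norm_sq_charFun_eq (ν : Measure ℝ) [IsProbabilityMeasure ν] (s : ℝ) :
    ‖charFun ν s‖ ^ 2 = ∫ z, Real.cos (s * (z.1 - z.2)) ∂(ν.prod ν) := by
  have h : ((‖charFun ν s‖ ^ 2 : ℝ) : ℂ) =
      ∫ z : ℝ × ℝ, Complex.exp ((s * (z.1 - z.2) : ℝ) * Complex.I) ∂(ν.prod ν) := by
    have h1 := Complex.mul_conj (charFun ν s)
    rw [← charFun_neg, Complex.normSq_eq_norm_sq] at h1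
    rw [← h1, charFun_apply_real, charFun_apply_real, ← integral_prod_mul]
    congr 1; ext z
    rw [← Complex.exp_add]; push_cast; ring_nf
  have h2 := congrArg Complex.re h
  rw [Complex.ofReal_re] at h2
  rw [h2]
  have hint : Integrable (fun z : ℝ × ℝ =>
      Complex.exp ((s * (z.1 - z.2) : ℝ) * Complex.I)) (ν.prod ν) := by
    refine Integrable.of_bound (C := 1) (Measurable.aestronglyMeasurable (by fun_prop)) ?_
    exact Filter.Eventually.of_forall fun z => by rw [Complex.norm_exp_ofReal_mul_I]
  have := integral_re hint
  simp only [RCLike.re_eq_complex_re] at this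
  rw [← this]
  congr 1; ext z
  rw [Complex.exp_ofReal_mul_I_re]

/-- The squared Euclidean distance from the restriction of `x` to the coordinates in `I` to the
integer lattice. -/
noncomputable def latDistSq {ι : Type*} (I : Finset ι) (x : ι → ℝ) : ℝ :=
  ∑ i ∈ I, (x i - round (x i)) ^ 2

lemma one_sub_cos_two_pi_mul_ge (y : ℝ) :
    8 * (y - round y) ^ 2 ≤ 1 - Real.cos (2 * Real.pi * y) := by
  have h1 : Real.cos (2 * Real.pi * y) = Real.cos (2 * Real.pi * (y - round y)) := by
    rw [show 2 * Real.pi * (y - round y) = 2 * Real.pi * y - (round y : ℤ) * (2 * Real.pi) by ring,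
      Real.cos_sub_int_mul_two_pi]
  have h2 := abs_sub_round y
  have hpi := Real.pi_pos
  have h3 := Real.cos_le_one_sub_mul_cos_sq (x := 2 * Real.pi * (y - round y)) (by
    rw [abs_mul, abs_of_pos (by positivity)]; nlinarith)
  rw [h1]
  have : 2 / Real.pi ^ 2 * (2 * Real.pi * (y - round y)) ^ 2 = 8 * (y - round y) ^ 2 := by
    field_simp; ring
  linarith

lemma latDistSq_nonneg {ι : Type*} (I : Finset ι) (x : ι → ℝ) : 0 ≤ latDistSq I x :=
  Finset.sum_nonneg fun _ _ => sq_nonneg _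

/-- The property of a probability law that is used below: with probability at least `p / 2`, two
independent samples are at a distance in `(ε, 2 K]`. -/
def HasSpread (ν : Measure ℝ) (ε p K : ℝ) : Prop :=
  p / 2 ≤ (ν.prod ν).real {z | ε < |z.1 - z.2| ∧ |z.1 - z.2| ≤ 2 * K}

lemma measurableSet_abs_sub_mem (ε K : ℝ) :
    MeasurableSet {z : ℝ × ℝ | ε < |z.1 - z.2| ∧ |z.1 - z.2| ≤ 2 * K} :=
  (measurableSet_lt (f := fun _ : ℝ × ℝ => ε) (g := fun z : ℝ × ℝ => |z.1 - z.2|) (by fun_prop)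
    (by fun_prop)).inter (measurableSet_le (f := fun z : ℝ × ℝ => |z.1 - z.2|)
    (g := fun _ : ℝ × ℝ => 2 * K) (by fun_prop) (by fun_prop))

lemma IsNondegenerateWith.hasSpread {Ω : Type*} [MeasurableSpace Ω] {P : Measure Ω}
    [IsProbabilityMeasure P] {X : Ω → ℝ} (hX : Measurable X) {ε p K : ℝ}
    (h : IsNondegenerateWith P X ε p K) : HasSpread (P.map X) ε p K := by
  have : IsProbabilityMeasure (P.map X) := Measure.isProbabilityMeasure_map hX.aemeasurable
  unfold HasSpread
  rw [Measure.map_prod_map P P hX hX, map_measureReal_apply (by fun_prop)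
    (measurableSet_abs_sub_mem ε K)]
  set S : Set (Ω × Ω) := {ω | |X ω.1 - X ω.2| ≤ ε}
  set T1 : Set (Ω × Ω) := Prod.fst ⁻¹' {ω | K < |X ω|}
  set T2 : Set (Ω × Ω) := Prod.snd ⁻¹' {ω | K < |X ω|}
  set G : Set (Ω × Ω) := Prod.map X X ⁻¹' {z | ε < |z.1 - z.2| ∧ |z.1 - z.2| ≤ 2 * K}
  have hK : MeasurableSet {ω | K < |X ω|} := measurableSet_lt measurable_const (by fun_prop)
  have hcov : Set.univ ⊆ G ∪ (S ∪ (T1 ∪ T2)) := by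
    intro ω _
    by_contra hc
    simp only [G, S, T1, T2, Set.mem_union, Set.mem_preimage, Set.mem_ofPred_eq, Prod.map_fst,
      Prod.map_snd, not_or, not_and, not_lt, not_le] at hc
    obtain ⟨h1, h2, h3, h4⟩ := hc
    have := h1 h2
    have := abs_sub (X ω.1) (X ω.2)
    linarith
  have t1 : (P.prod P).real T1 ≤ p / 4 := by
    have : (P.prod P).real T1 = P.real {ω | K < |X ω|} := by
      simp only [measureReal_def]; rw [← Measure.map_apply measurable_fst hK]; simp
    rw [this]; exact h.tail
  have t2 : (P.prod P).real T2 ≤ p / 4 := by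
    have : (P.prod P).real T2 = P.real {ω | K < |X ω|} := by
      simp only [measureReal_def]; rw [← Measure.map_apply measurable_snd hK]; simp
    rw [this]; exact h.tail
  have h0 : (1 : ℝ) ≤ (P.prod P).real G + ((P.prod P).real S + ((P.prod P).real T1 +
      (P.prod P).real T2)) := by
    calc (1 : ℝ) = (P.prod P).real Set.univ := by simp
      _ ≤ (P.prod P).real (G ∪ (S ∪ (T1 ∪ T2))) := measureReal_mono hcov
      _ ≤ _ := (measureReal_union_le _ _).trans (add_le_add le_rfl
          ((measureReal_union_le _ _).trans (add_le_add le_rfl (measureReal_union_le _ _))))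
  have := h.antiConcentration
  linarith

/-- If every dilate `θ • x` with `θ` in the relevant window is far from the integer lattice, then
the product of characteristic functions is small. The window comes from the typical size
`[ε, 2 K]` of the difference of two independent samples. -/
theorem prod_norm_charFun_le (ν : Measure ℝ) [IsProbabilityMeasure ν] {ε p K : ℝ}
    (hν : HasSpread ν ε p K) {ι : Type*} (I : Finset ι) (x : ι → ℝ) (t β : ℝ)
    (hβ : 0 ≤ β)
    (h : ∀ θ, |t| * ε / (2 * Real.pi) ≤ θ → θ ≤ |t| * (2 * K) / (2 * Real.pi) →
      β ≤ latDistSq I (fun i => θ * x i)) :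
    ∏ i ∈ I, ‖charFun ν (t * x i)‖ ≤ Real.exp (-2 * p * β) := by
  set Q : Measure (ℝ × ℝ) := ν.prod ν
  set S : Set (ℝ × ℝ) := {z | ε < |z.1 - z.2| ∧ |z.1 - z.2| ≤ 2 * K}
  have hS : MeasurableSet S := measurableSet_abs_sub_mem ε K
  have hpi := Real.pi_pos
  have hci : ∀ s : ℝ, Integrable (fun z : ℝ × ℝ => 1 - Real.cos (s * (z.1 - z.2))) Q := by
    intro s
    refine Integrable.of_bound (C := 2) (Measurable.aestronglyMeasurable (by fun_prop)) ?_
    refine Filter.Eventually.of_forall fun z => ?_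
    rw [Real.norm_eq_abs, abs_le]
    constructor <;> linarith [Real.cos_le_one (s * (z.1 - z.2)), Real.neg_one_le_cos (s * (z.1 - z.2))]
  have h1 : ∀ s : ℝ, ‖charFun ν s‖ ^ 2 ≤ Real.exp (-∫ z, (1 - Real.cos (s * (z.1 - z.2))) ∂Q) := by
    intro s
    rw [norm_sq_charFun_eq]
    have hc : Integrable (fun z : ℝ × ℝ => Real.cos (s * (z.1 - z.2))) Q := by
      have := (integrable_const (1 : ℝ)).sub (hci s)
      simpa [Pi.sub_def] using this
    have : ∫ z, (1 - Real.cos (s * (z.1 - z.2))) ∂Q = 1 - ∫ z, Real.cos (s * (z.1 - z.2)) ∂Q := by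
      rw [integral_sub (integrable_const _) hc]; simp
    rw [this]
    have := Real.one_sub_le_exp_neg (1 - ∫ z, Real.cos (s * (z.1 - z.2)) ∂Q)
    simpa [Q] using this
  have h2 : (∏ i ∈ I, ‖charFun ν (t * x i)‖) ^ 2 ≤
      Real.exp (-∫ z, ∑ i ∈ I, (1 - Real.cos (t * x i * (z.1 - z.2))) ∂Q) := by
    rw [integral_finsetSum _ (fun i _ => hci _), ← Finset.sum_neg_distrib, Real.exp_sum,
      ← Finset.prod_pow]
    exact Finset.prod_le_prod (fun _ _ => by positivity) fun i _ => h1 _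
  have h3 : 4 * p * β ≤ ∫ z, ∑ i ∈ I, (1 - Real.cos (t * x i * (z.1 - z.2))) ∂Q := by
    have hsum : Integrable (fun z : ℝ × ℝ => ∑ i ∈ I, (1 - Real.cos (t * x i * (z.1 - z.2)))) Q :=
      integrable_finsetSum _ fun i _ => hci _
    calc 4 * p * β = (p / 2) * (8 * β) := by ring
      _ ≤ Q.real S * (8 * β) := by gcongr; exact hν
      _ = ∫ z in S, (8 * β) ∂Q := by rw [setIntegral_const, smul_eq_mul]
      _ ≤ ∫ z in S, ∑ i ∈ I, (1 - Real.cos (t * x i * (z.1 - z.2))) ∂Q := by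
          refine setIntegral_mono_on (integrable_const _).integrableOn hsum.integrableOn hS ?_
          intro z hz
          set θ := |t| * |z.1 - z.2| / (2 * Real.pi) with hθ
          -- `1 - cos` of the phase is bounded below by the squared distance of `θ * x i` to `ℤ`.
          have hb := h θ (by rw [hθ]; have := hz.1; gcongr) (by rw [hθ]; have := hz.2; gcongr)
          unfold latDistSq at hb
          calc 8 * β ≤ 8 * ∑ i ∈ I, (θ * x i - round (θ * x i)) ^ 2 := by linarith
            _ = ∑ i ∈ I, 8 * (θ * x i - round (θ * x i)) ^ 2 := Finset.mul_sum _ _ _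
            _ ≤ _ := by
              refine Finset.sum_le_sum fun i _ => (one_sub_cos_two_pi_mul_ge _).trans (le_of_eq ?_)
              congr 1
              have : 2 * Real.pi * (θ * x i) = |t * (z.1 - z.2)| * x i := by
                rw [hθ, abs_mul]; field_simp
              rw [this, show t * x i * (z.1 - z.2) = (t * (z.1 - z.2)) * x i by ring]
              rcases abs_choice (t * (z.1 - z.2)) with h | h <;> rw [h]
              rw [neg_mul, Real.cos_neg]
      _ ≤ _ := setIntegral_le_integral hsum (Filter.Eventually.of_forall fun z =>
          Finset.sum_nonneg fun i _ => by linarith [Real.cos_le_one (t * x i * (z.1 - z.2))])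
  have h4 : (∏ i ∈ I, ‖charFun ν (t * x i)‖) ^ 2 ≤ Real.exp (-2 * p * β) ^ 2 := by
    refine h2.trans ?_
    rw [← Real.exp_nat_mul]
    apply Real.exp_le_exp.2
    push_cast; linarith
  exact (sq_le_sq₀ (Finset.prod_nonneg fun _ _ => norm_nonneg _) (Real.exp_pos _).le).1 h4

/-! ### Small-ball bounds for linear forms -/

/-- The Gaussian average of the modulus of the characteristic function of `∑ i ∈ I, x i * X i`, where
the `X i` are independent with law `ν`. It bounds the Gaussian weight of every translate of this
random variable, and so its concentration on intervals of length of order one. -/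
noncomputable def gaussAvg {ι : Type*} (ν : Measure ℝ) (I : Finset ι) (x : ι → ℝ) : ℝ :=
  ∫ t, ∏ i ∈ I, ‖charFun ν (t * x i)‖ ∂(gaussianReal 0 1)

/-- The vector `x`, restricted to `I`, has no dilate by a factor of at most `D` that is close to the
integer lattice: the least common denominator of `x`, in the sense of Rudelson and Vershynin, is at
least `D`. The parameter `η` stands for a small multiple of the norm of the restriction; the distance
has to exceed `η * θ` only up to the cap `κ`. -/
def FarFromLattice {ι : Type*} (I : Finset ι) (η κ D : ℝ) (x : ι → ℝ) : Prop :=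
  ∀ θ : ℝ, 0 < θ → θ ≤ D → min (η * θ) κ ^ 2 ≤ latDistSq I (fun i => θ * x i)

lemma integral_exp_neg_mul_sq_gaussianReal (a : ℝ) (ha : 0 < 1 + 2 * a) :
    ∫ t, Real.exp (-a * t ^ 2) ∂(gaussianReal 0 1) = 1 / √(1 + 2 * a) := by
  rw [integral_gaussianReal_eq_integral_smul one_ne_zero]
  have : ∀ t : ℝ, gaussianPDFReal 0 1 t • Real.exp (-a * t ^ 2) =
      (√(2 * Real.pi))⁻¹ * Real.exp (-((1 + 2 * a) / 2) * t ^ 2) := by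
    intro t
    simp only [gaussianPDFReal, NNReal.coe_one, mul_one, sub_zero, smul_eq_mul]
    rw [mul_assoc, ← Real.exp_add]
    congr 2; ring
  simp_rw [this]
  rw [integral_const_mul, integral_gaussian,
    show Real.pi / ((1 + 2 * a) / 2) = (2 * Real.pi) / (1 + 2 * a) by field_simp,
    Real.sqrt_div (by positivity)]
  have : √(2 * Real.pi) ≠ 0 := by positivity
  field_simp

lemma integrable_exp_neg_mul_sq_gaussianReal (a : ℝ) (ha : 0 < 1 + 2 * a) :
    Integrable (fun t => Real.exp (-a * t ^ 2)) (gaussianReal 0 1) := by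
  by_contra h
  have := integral_undef h
  rw [integral_exp_neg_mul_sq_gaussianReal a ha] at this
  have : 0 < 1 / √(1 + 2 * a) := by positivity
  linarith

lemma prod_norm_charFun_le_one {ι : Type*} (ν : Measure ℝ) [IsProbabilityMeasure ν] (I : Finset ι)
    (y : ι → ℝ) : ∏ i ∈ I, ‖charFun ν (y i)‖ ≤ 1 :=
  Finset.prod_le_one (fun _ _ => norm_nonneg _) fun _ _ => norm_charFun_le_one _

lemma measurable_prod_norm_charFun {ι : Type*} (ν : Measure ℝ) [IsProbabilityMeasure ν]
    (I : Finset ι) (x : ι → ℝ) : Measurable fun t : ℝ => ∏ i ∈ I, ‖charFun ν (t * x i)‖ := by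
  have := (continuous_charFun (μ := ν)).measurable
  fun_prop

lemma integrable_prod_norm_charFun {ι : Type*} (ν : Measure ℝ) [IsProbabilityMeasure ν]
    (I : Finset ι) (x : ι → ℝ) :
    Integrable (fun t : ℝ => ∏ i ∈ I, ‖charFun ν (t * x i)‖) (gaussianReal 0 1) := by
  refine Integrable.of_bound (C := 1) (measurable_prod_norm_charFun ν I x).aestronglyMeasurable ?_
  refine Filter.Eventually.of_forall fun t => ?_
  rw [Real.norm_eq_abs, abs_of_nonneg (Finset.prod_nonneg fun _ _ => norm_nonneg _)]
  exact prod_norm_charFun_le_one ν I _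

lemma gaussAvg_nonneg {ι : Type*} (ν : Measure ℝ) (I : Finset ι) (x : ι → ℝ) :
    0 ≤ gaussAvg ν I x :=
  integral_nonneg fun _ => Finset.prod_nonneg fun _ _ => norm_nonneg _

/-- Small-ball bound for vectors far from the lattice, at every scale `r` above `K * κ / D`. -/
theorem gaussAvg_le_of_farFromLattice {ι : Type*} (ν : Measure ℝ) [IsProbabilityMeasure ν]
    {ε p K : ℝ} (hε : 0 < ε) (hp : 0 < p) (hK : 0 < K) (hν : HasSpread ν ε p K) (I : Finset ι)
    (x : ι → ℝ) {η κ D r : ℝ} (hη : 0 < η) (hκ : 0 < κ) (hr : 0 < r) (hD : K * κ ≤ r * D)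
    (hx : FarFromLattice I η κ D x) :
    gaussAvg ν I (fun i => x i / r) ≤
      4 * r / (√p * η * ε) + Real.exp (-2 * p * κ ^ 2) + 2 * Real.exp (-κ ^ 2 / 4) := by
  have hpi := Real.pi_pos
  have hpi3 := Real.pi_gt_three
  set a : ℝ := 2 * p * (η * ε / (2 * Real.pi * r)) ^ 2 with ha
  have ha0 : 0 < a := by positivity
  have key : ∀ t : ℝ, ∏ i ∈ I, ‖charFun ν (t * (x i / r))‖ ≤
      Real.exp (-a * t ^ 2) + Real.exp (-2 * p * κ ^ 2) +
        Real.exp (-κ ^ 2 / 4) * Real.exp (-(-1 / 4) * t ^ 2) := by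
    intro t
    -- The hypothesis covers the dilates that occur for `|t| ≤ κ`; larger `t` have small Gaussian mass.
    by_cases ht : |t| ≤ κ
    · set s : ℝ := |t| * ε / (2 * Real.pi * r) with hs
      have hs0 : 0 ≤ s := by positivity
      have h1 := prod_norm_charFun_le ν hν I (fun i => x i / r) t (min (η * s) κ ^ 2)
        (sq_nonneg _) (by
          intro θ h1 h2
          rcases eq_or_ne t 0 with rfl | ht0
          · have : s = 0 := by simp [hs]
            rw [this, mul_zero, min_eq_left hκ.le]; simpa using latDistSq_nonneg _ _
          have hθ0 : 0 < θ := lt_of_lt_of_le (by have := abs_pos.2 ht0; positivity) h1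
          have h3 := hx (θ / r) (by positivity) (by
            rw [div_le_iff₀ hr]
            refine h2.trans ?_
            rw [div_le_iff₀ (by positivity)]
            have : |t| * (2 * K) ≤ κ * (2 * K) := by gcongr
            have h5 : 0 ≤ D * r := by nlinarith
            nlinarith)
          have h4 : s ≤ θ / r := by
            rw [hs, le_div_iff₀ hr]; refine le_trans (le_of_eq ?_) h1; field_simp
          have e : (fun i => θ * (x i / r)) = fun i => θ / r * x i := by ext i; ring
          rw [e]
          refine le_trans ?_ h3
          have : 0 ≤ min (η * s) κ := le_min (by positivity) hκ.le
          gcongr)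
      refine h1.trans ?_
      have hpos : 0 ≤ Real.exp (-κ ^ 2 / 4) * Real.exp (-(-1 / 4) * t ^ 2) := by positivity
      rcases min_choice (η * s) κ with h | h <;> rw [h]
      · have : -2 * p * (η * s) ^ 2 = -a * t ^ 2 := by
          rw [hs, ha, ← sq_abs t]; field_simp
        rw [this]; have := Real.exp_pos (-2 * p * κ ^ 2); linarith
      · have := Real.exp_pos (-a * t ^ 2); linarith
    · push Not at ht
      refine (prod_norm_charFun_le_one ν I _).trans ?_
      rw [← Real.exp_add]
      have h1 : (1 : ℝ) ≤ Real.exp (-κ ^ 2 / 4 + -(-1 / 4) * t ^ 2) := by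
        apply Real.one_le_exp
        have : κ ^ 2 ≤ |t| ^ 2 := by gcongr
        rw [sq_abs] at this
        linarith
      have := Real.exp_pos (-a * t ^ 2)
      have := Real.exp_pos (-2 * p * κ ^ 2)
      linarith
  have i1 := integrable_exp_neg_mul_sq_gaussianReal a (by linarith)
  have i2 := integrable_exp_neg_mul_sq_gaussianReal (-1 / 4) (by norm_num)
  have h := integral_mono (integrable_prod_norm_charFun ν I (fun i => x i / r))
    ((i1.add (integrable_const (Real.exp (-2 * p * κ ^ 2)))).add
      (i2.const_mul (Real.exp (-κ ^ 2 / 4)))) key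
  refine h.trans ?_
  simp only [Pi.add_apply]
  rw [integral_add (by exact i1.add (integrable_const _)) (i2.const_mul _),
    integral_add i1 (integrable_const _), integral_const_mul,
    integral_exp_neg_mul_sq_gaussianReal a (by linarith),
    integral_exp_neg_mul_sq_gaussianReal (-1 / 4) (by norm_num)]
  have e1 : 1 / √(1 + 2 * a) ≤ 4 * r / (√p * η * ε) := by
    have h1 : √p * η * ε / (Real.pi * r) ≤ √(1 + 2 * a) := by
      apply Real.le_sqrt_of_sq_le
      have : (√p * η * ε / (Real.pi * r)) ^ 2 = 2 * a := by
        rw [ha, div_pow, mul_pow, mul_pow, Real.sq_sqrt hp.le]; field_simp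
      linarith
    have hsp : 0 < √p := Real.sqrt_pos.2 hp
    calc 1 / √(1 + 2 * a) ≤ 1 / (√p * η * ε / (Real.pi * r)) := by gcongr
      _ = Real.pi * r / (√p * η * ε) := by field_simp
      _ ≤ _ := by gcongr; exact Real.pi_lt_four.le
  have e2 : 1 / √(1 + 2 * (-1 / 4 : ℝ)) ≤ 2 := by
    rw [div_le_iff₀ (by apply Real.sqrt_pos.2; norm_num)]
    have : (1 / 2 : ℝ) ≤ √(1 + 2 * (-1 / 4 : ℝ)) := by
      apply Real.le_sqrt_of_sq_le; norm_num
    linarith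
  have := mul_le_mul_of_nonneg_left e2 (Real.exp_pos (-κ ^ 2 / 4)).le
  simp only [integral_const, probReal_univ, smul_eq_mul, one_mul]
  linarith

lemma abs_le_abs_sub_round {y : ℝ} (hy : |y| ≤ 1 / 2) : |y| ≤ |y - round y| := by
  rcases eq_or_ne (round y) 0 with h | h
  · rw [h]; simp
  · have h1 : (1 : ℝ) ≤ |(round y : ℝ)| := by
      have := Int.one_le_abs h
      exact_mod_cast this
    have := abs_sub_abs_le_abs_sub (round y : ℝ) y
    rw [abs_sub_comm] at this
    linarith

lemma mul_sq_le_latDistSq {ι : Type*} (I : Finset ι) (x : ι → ℝ) (θ : ℝ)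
    (h : ∀ i ∈ I, |θ * x i| ≤ 1 / 2) :
    θ ^ 2 * ∑ i ∈ I, x i ^ 2 ≤ latDistSq I (fun i => θ * x i) := by
  rw [Finset.mul_sum]
  refine Finset.sum_le_sum fun i hi => ?_
  rw [← mul_pow]
  exact sq_le_sq.2 (abs_le_abs_sub_round (h i hi))

/-- A linear form whose coefficient vector has norm of order one cannot concentrate near a point
with probability close to one. -/
theorem exists_gaussAvg_le {ε p K : ℝ} (hε : 0 < ε) (hp : 0 < p) (hK : 0 < K) :
    ∃ g : ℝ, 0 < g ∧ g < 1 ∧ ∀ (ν : Measure ℝ) [IsProbabilityMeasure ν], HasSpread ν ε p K →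
      ∀ {ι : Type} (I : Finset ι) (x : ι → ℝ), (∀ i ∈ I, |x i| ≤ 1) → 1 / 2 ≤ ∑ i ∈ I, x i ^ 2 →
        gaussAvg ν I (fun i => x i / K) ≤ g := by
  have hpi := Real.pi_pos
  have hpi3 := Real.pi_gt_three
  set c : ℝ := p * (ε / (4 * Real.pi * K)) ^ 2 with hc
  have hc0 : 0 < c := by positivity
  set w : ℝ := (gaussianReal 0 1).real (Set.Icc (1 / 2) 1) with hw
  have hw0 : 0 < w := by
    rw [hw, measureReal_def]
    refine ENNReal.toReal_pos (fun h => ?_) (measure_ne_top _ _)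
    have := gaussianReal_absolutelyContinuous' 0 (one_ne_zero) h
    rw [Real.volume_Icc] at this
    norm_num at this
  have hw1 : w ≤ 1 := measureReal_le_one
  have hec : Real.exp (-c) < 1 := by rw [Real.exp_lt_one_iff]; linarith
  have hec0 := Real.exp_pos (-c)
  refine ⟨1 - (1 - Real.exp (-c)) * w, by nlinarith, by nlinarith, ?_⟩
  intro ν _ hν ι I x hx1 hx2
  have key : ∀ t : ℝ, ∏ i ∈ I, ‖charFun ν (t * (x i / K))‖ ≤
      1 - (Set.Icc (1 / 2 : ℝ) 1).indicator (fun _ => (1 - Real.exp (-c))) t := by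
    intro t
    by_cases ht : t ∈ Set.Icc (1 / 2 : ℝ) 1
    · rw [Set.indicator_of_mem ht, sub_sub_cancel]
      have ht0 : |t| = t := abs_of_nonneg (by linarith [ht.1])
      have h1 := prod_norm_charFun_le ν hν I (fun i => x i / K) t
        ((|t| * ε / (2 * Real.pi)) ^ 2 * (1 / (2 * K ^ 2))) (by positivity) (by
          intro θ h1 h2
          have hθ : 0 ≤ θ := le_trans (by positivity) h1
          have hθ2 : θ / K ≤ 1 / 2 := by
            rw [div_le_iff₀ hK]; refine h2.trans ?_
            rw [div_le_iff₀ (by positivity), ht0]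
            have := ht.2
            nlinarith
          refine le_trans ?_ (mul_sq_le_latDistSq I _ θ ?_)
          · have e : ∑ i ∈ I, (x i / K) ^ 2 = (∑ i ∈ I, x i ^ 2) * (1 / K ^ 2) := by
              rw [Finset.sum_mul]; refine Finset.sum_congr rfl fun i _ => by field_simp
            rw [e]
            have : 1 / (2 * K ^ 2) = 1 / 2 * (1 / K ^ 2) := by field_simp
            rw [this]
            gcongr
          · intro i hi
            rw [show θ * (x i / K) = (θ / K) * x i by ring, abs_mul,
              abs_of_nonneg (div_nonneg hθ hK.le)]
            have := hx1 i hi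
            have : 0 ≤ θ / K := by positivity
            nlinarith [abs_nonneg (x i)])
      refine h1.trans (Real.exp_le_exp.2 ?_)
      rw [ht0]
      have e : -2 * p * ((t * ε / (2 * Real.pi)) ^ 2 * (1 / (2 * K ^ 2))) = -c * (4 * t ^ 2) := by
        rw [hc]; field_simp; ring
      rw [e]
      have : 1 ≤ 4 * t ^ 2 := by nlinarith [ht.1]
      nlinarith
    · rw [Set.indicator_of_notMem ht, sub_zero]
      exact prod_norm_charFun_le_one ν I _
  have hind : Integrable ((Set.Icc (1 / 2 : ℝ) 1).indicator (fun _ => (1 - Real.exp (-c))))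
      (gaussianReal 0 1) := (integrable_const _).indicator measurableSet_Icc
  refine (integral_mono (integrable_prod_norm_charFun ν I _)
    ((integrable_const (1 : ℝ)).sub hind) key).trans (le_of_eq ?_)
  simp only [Pi.sub_apply]
  rw [integral_sub (integrable_const _) hind, integral_indicator_const _ measurableSet_Icc]
  simp [hw, mul_comm]

/-! ### Small-ball bounds for random vectors and Wigner matrices -/

/-- Small-ball bound for a vector of affine forms in independent variables, provided that the
characteristic functions decouple into one copy of `∏ i ∈ I, ‖charFun ν (t * x i)‖` per form. -/
theorem measureReal_sum_sq_le_le {Ω : Type*} [MeasurableSpace Ω] (P : Measure Ω)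
    [IsProbabilityMeasure P] {E J ι : Type*} [Fintype E] [Fintype J] (X : E → Ω → ℝ)
    (hX : ∀ e, Measurable (X e)) (hind : iIndepFun X P) (A : J → E → ℝ) (u : J → ℝ)
    (ν : Measure ℝ) [IsProbabilityMeasure ν] (I : Finset ι) (x : ι → ℝ)
    (hdec : ∀ t : J → ℝ, ∏ e, ‖charFun (P.map (X e)) (∑ j, t j * A j e)‖ ≤
      ∏ j, ∏ i ∈ I, ‖charFun ν (t j * x i)‖) (L : ℝ) :
    P.real {ω | ∑ j, (∑ e, A j e * X e ω + u j) ^ 2 ≤ L} ≤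
      Real.exp (L / 2) * gaussAvg ν I x ^ Fintype.card J := by
  have hprob : ∀ e, IsProbabilityMeasure (P.map (X e)) := fun e =>
    Measure.isProbabilityMeasure_map (hX e).aemeasurable
  have h1 := integral_prod_exp_neg_sq_le P X hX hind A u
  have h2 : ∫ t : J → ℝ, ∏ e, ‖charFun (P.map (X e)) (∑ j, t j * A j e)‖
        ∂(Measure.pi fun _ => gaussianReal 0 1) ≤ gaussAvg ν I x ^ Fintype.card J := by
    have e : gaussAvg ν I x ^ Fintype.card J =
        ∫ t : J → ℝ, ∏ j, ∏ i ∈ I, ‖charFun ν (t j * x i)‖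
          ∂(Measure.pi fun _ => gaussianReal 0 1) := by
      rw [integral_fintype_prod_eq_prod (μ := fun _ : J => gaussianReal 0 1)
        (fun (_ : J) (t : ℝ) => ∏ i ∈ I, ‖charFun ν (t * x i)‖)]
      simp [gaussAvg]
    rw [e]
    refine integral_mono_of_nonneg (Filter.Eventually.of_forall fun t =>
      Finset.prod_nonneg fun _ _ => norm_nonneg _) ?_ (Filter.Eventually.of_forall hdec)
    refine Integrable.of_bound (C := 1) ?_ (Filter.Eventually.of_forall fun t => ?_)
    · have := (continuous_charFun (μ := ν)).measurable
      exact Measurable.aestronglyMeasurable (by fun_prop)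
    · rw [Real.norm_eq_abs, abs_of_nonneg (Finset.prod_nonneg fun _ _ =>
        Finset.prod_nonneg fun _ _ => norm_nonneg _)]
      exact Finset.prod_le_one (fun _ _ => Finset.prod_nonneg fun _ _ => norm_nonneg _)
        fun j _ => prod_norm_charFun_le_one ν I _
  set Z : Ω → ℝ := fun ω => ∏ j, Real.exp (-(∑ e, A j e * X e ω + u j) ^ 2 / 2) with hZ
  have hZm : Measurable Z := by fun_prop
  have hZi : Integrable Z P := by
    refine Integrable.of_bound (C := 1) hZm.aestronglyMeasurable
      (Filter.Eventually.of_forall fun ω => ?_)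
    rw [Real.norm_eq_abs, abs_of_nonneg (Finset.prod_nonneg fun _ _ => (Real.exp_pos _).le)]
    refine Finset.prod_le_one (fun _ _ => (Real.exp_pos _).le) fun j _ => ?_
    rw [Real.exp_le_one_iff]
    have := sq_nonneg (∑ e, A j e * X e ω + u j)
    linarith
  have h3 : P.real {ω | ∑ j, (∑ e, A j e * X e ω + u j) ^ 2 ≤ L} ≤
      P.real {ω | Real.exp (-L / 2) ≤ Z ω} := by
    refine measureReal_mono fun ω hω => ?_
    simp only [Set.mem_ofPred_eq, hZ] at hω ⊢
    rw [← Real.exp_sum, Real.exp_le_exp, ← Finset.sum_div, Finset.sum_neg_distrib]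
    linarith
  have h4 := mul_meas_ge_le_integral_of_nonneg (μ := P) (f := Z)
    (Filter.Eventually.of_forall fun ω => Finset.prod_nonneg fun _ _ => (Real.exp_pos _).le)
    hZi (Real.exp (-L / 2))
  have h5 : P.real {ω | Real.exp (-L / 2) ≤ Z ω} =
      Real.exp (L / 2) * (Real.exp (-L / 2) * P.real {ω | Real.exp (-L / 2) ≤ Z ω}) := by
    rw [← mul_assoc, ← Real.exp_add]; simp [neg_div]
  refine h3.trans ?_
  rw [h5]
  exact mul_le_mul_of_nonneg_left (h4.trans (h1.trans h2)) (Real.exp_pos _).le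

/-- Anti-concentration of a linear form with fixed coefficients in iid variables. -/
theorem measureReal_sum_eq_zero_le {Ω : Type*} [MeasurableSpace Ω] (P : Measure Ω)
    [IsProbabilityMeasure P] {n : ℕ} (X : Fin n → Ω → ℝ) (hX : ∀ e, Measurable (X e))
    (hind : iIndepFun X P) (ν : Measure ℝ) [IsProbabilityMeasure ν] (hν : ∀ e, P.map (X e) = ν)
    (I : Finset (Fin n)) (y : Fin n → ℝ) (r : ℝ) :
    P.real {ω | ∑ i, y i * X i ω = 0} ≤ gaussAvg ν I (fun i => y i / r) := by
  have h := measureReal_sum_sq_le_le P X hX hind (fun (_ : Unit) i => y i / r) (fun _ => 0) ν I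
    (fun i => y i / r) (by
      intro t
      simp only [Finset.univ_unique, Finset.sum_singleton, Finset.prod_singleton, hν]
      exact Finset.prod_le_prod_of_subset_of_le_one (Finset.subset_univ I)
        (fun _ _ => norm_nonneg _) (fun _ _ _ => norm_charFun_le_one _)) 0
  simp only [zero_div, Real.exp_zero, one_mul, Fintype.card_unit, pow_one] at h
  refine le_trans (measureReal_mono fun ω hω => ?_) h
  simp only [Set.mem_ofPred_eq] at hω ⊢
  have : ∑ i, y i / r * X i ω = (∑ i, y i * X i ω) / r := by
    rw [Finset.sum_div]; exact Finset.sum_congr rfl fun i _ => by ring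
  simp [this, hω]

/-- The position on or above the diagonal of the entry `(j, i)` of a symmetric matrix. -/
def upperEntry {n : ℕ} (j i : Fin n) : {e : Fin n × Fin n // e.1 ≤ e.2} :=
  ⟨(min j i, max j i), min_le_max⟩

lemma IsWigner.apply_upperEntry {Ω Ω₀ : Type*} [MeasurableSpace Ω] [MeasurableSpace Ω₀]
    {P : Measure Ω} {P₀ : Measure Ω₀} {n : ℕ} {W : Ω → Matrix (Fin n) (Fin n) ℝ} {ξ ζ : Ω₀ → ℝ}
    (hW : IsWigner P P₀ W ξ ζ) (j i : Fin n) (ω : Ω) :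
    W ω (upperEntry j i).1.1 (upperEntry j i).1.2 = W ω j i := by
  simp only [upperEntry]
  rcases le_total j i with h | h
  · rw [min_eq_left h, max_eq_right h]
  · rw [min_eq_right h, max_eq_left h, (hW.symm ω).apply]

/-- Small-ball bound for `W y - μ y` with `y` fixed. Only the rows outside `I` and the columns in
`I` are used; the corresponding block of `W` has independent entries. -/
theorem IsWigner.measureReal_sum_sq_le {Ω Ω₀ : Type*} [MeasurableSpace Ω] [MeasurableSpace Ω₀]
    {P : Measure Ω} [IsProbabilityMeasure P] {P₀ : Measure Ω₀} {n : ℕ}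
    {W : Ω → Matrix (Fin n) (Fin n) ℝ} {ξ ζ : Ω₀ → ℝ} (hW : IsWigner P P₀ W ξ ζ)
    [IsProbabilityMeasure (P₀.map ξ)] (I : Finset (Fin n)) (y : Fin n → ℝ) (μ r L : ℝ)
    (hr : 0 < r) :
    P.real {ω | ∑ j, ((W ω).mulVec y j - μ * y j) ^ 2 ≤ L} ≤
      Real.exp (L / (2 * r ^ 2)) * gaussAvg (P₀.map ξ) I (fun i => y i / r) ^ (n - I.card) := by
  classical
  set ν := P₀.map ξ with hνdef
  set X : {e : Fin n × Fin n // e.1 ≤ e.2} → Ω → ℝ := fun e ω => W ω e.1.1 e.1.2 with hX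
  -- Coefficients of the rows `j ∉ I` of `W y` as linear forms in the independent entries.
  set A : {j // j ∉ I} → {e : Fin n × Fin n // e.1 ≤ e.2} → ℝ := fun j e =>
    (if e.1.1 = j then y e.1.2 else if e.1.2 = j then y e.1.1 else 0) / r with hA
  have hAe : ∀ (j : {j // j ∉ I}) (i : Fin n), A j (upperEntry j i) = y i / r := by
    intro j i
    simp only [hA, upperEntry]
    rcases le_total j.1 i with h | h
    · simp [h]
    · simp only [min_eq_right h, max_eq_left h, if_true]
      split_ifs with h' <;> simp [h']
  have hrow : ∀ (j : {j // j ∉ I}) ω, ∑ e, A j e * X e ω = (W ω).mulVec y j / r := by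
    intro j ω
    rw [Matrix.mulVec, dotProduct, Finset.sum_div]
    symm
    refine Finset.sum_of_injOn (upperEntry j.1) ?_ (fun _ _ => Finset.mem_coe.2 (Finset.mem_univ _))
      ?_ ?_
    · intro i _ i' _ h
      simp only [upperEntry, Subtype.mk.injEq, Prod.mk.injEq] at h
      obtain ⟨h1, h2⟩ := h
      rcases le_total j.1 i with a | a <;> rcases le_total j.1 i' with b | b <;>
        simp [a, b] at h1 h2 <;> omega
    · intro e _ he
      have h1 : e.1.1 ≠ j := by
        rintro h; apply he
        refine ⟨e.1.2, by simp, Subtype.ext ?_⟩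
        have := e.2
        simp only [upperEntry]; rw [← h, min_eq_left this, max_eq_right this]
      have h2 : e.1.2 ≠ j := by
        rintro h; apply he
        refine ⟨e.1.1, by simp, Subtype.ext ?_⟩
        have := e.2
        simp only [upperEntry]; rw [← h, min_eq_right this, max_eq_left this]
      simp [hA, h1, h2]
    · intro i _
      rw [hAe, hX]
      simp only [hW.apply_upperEntry]
      ring
  have hcard : Fintype.card {j // j ∉ I} = n - I.card := by
    simp
  have hdec : ∀ t : {j // j ∉ I} → ℝ, ∏ e, ‖charFun (P.map (X e)) (∑ j, t j * A j e)‖ ≤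
      ∏ j, ∏ i ∈ I, ‖charFun ν (t j * (y i / r))‖ := by
    intro t
    have hp : ∀ e, IsProbabilityMeasure (P.map (X e)) := fun e =>
      Measure.isProbabilityMeasure_map (hW.measurable _ _).aemeasurable
    rw [← Finset.prod_product']
    -- Keep only the entries with row outside `I` and column in `I`. Such an entry meets a single one
    -- of the forms, so its coefficient is `t j * y i` without a symmetric counterpart.
    set s : Finset ({j // j ∉ I} × Fin n) := Finset.univ ×ˢ I with hs
    set φ : {j // j ∉ I} × Fin n → {e : Fin n × Fin n // e.1 ≤ e.2} :=
      fun z => upperEntry z.1.1 z.2 with hφ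
    have hinj : Set.InjOn φ s := by
      rintro ⟨⟨j, hj⟩, i⟩ hz ⟨⟨j', hj'⟩, i'⟩ hz' h
      simp only [hs, Finset.coe_product, Set.mem_prod, Finset.mem_coe] at hz hz'
      have hi := hz.2
      have hi' := hz'.2
      simp only [hφ, upperEntry, Subtype.mk.injEq, Prod.mk.injEq] at h
      obtain ⟨h1, h2⟩ := h
      have hne : j' ≠ i := fun h => hj' (h ▸ hi)
      have hne' : j ≠ i' := fun h => hj (h ▸ hi')
      have : j = j' ∧ i = i' := by
        rcases le_total j i with a | a <;> rcases le_total j' i' with b | b <;>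
          simp only [min_eq_left, min_eq_right, max_eq_left, max_eq_right, a, b] at h1 h2 <;>
          first | exact ⟨h1, h2⟩ | exact ⟨h2, h1⟩ | exact absurd h1 hne' | exact absurd h2 hne'
      simp [this]
    have himg : ∏ z ∈ s, ‖charFun ν (t z.1 * (y z.2 / r))‖ =
        ∏ e ∈ s.image φ, ‖charFun (P.map (X e)) (∑ j, t j * A j e)‖ := by
      rw [Finset.prod_image hinj]
      refine Finset.prod_congr rfl ?_
      rintro ⟨j, i⟩ hz
      have hi : i ∈ I := (Finset.mem_product.1 hz).2
      have hji : j.1 ≠ i := fun h => j.2 (h ▸ hi)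
      have hsum : ∑ j', t j' * A j' (φ (j, i)) = t j * (y i / r) := by
        rw [Finset.sum_eq_single j]
        · simp only [hφ]; rw [hAe]
        · intro j' _ hj'
          have hne : i ≠ j'.1 := fun h => j'.2 (h ▸ hi)
          have hne' : j.1 ≠ j'.1 := fun h => hj' (Subtype.ext h.symm)
          have : A j' (φ (j, i)) = 0 := by
            simp only [hA, hφ, upperEntry]
            rcases le_total j.1 i with a | a <;> simp [a, hne, hne']
          rw [this, mul_zero]
        · simp
      have hmap : P.map (X (φ (j, i))) = ν := by
        refine (hW.offDiag _ _ ?_).map_eq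
        simp only [hφ, upperEntry]
        exact min_lt_max.2 hji
      simp only
      rw [hsum, hmap]
    rw [himg]
    exact Finset.prod_le_prod_of_subset_of_le_one (Finset.subset_univ _)
        (fun _ _ => norm_nonneg _) (fun _ _ _ => norm_charFun_le_one _)
  have h := measureReal_sum_sq_le_le P X (fun e => hW.measurable _ _) hW.indep A
    (fun j => -(μ * y j / r)) ν I (fun i => y i / r) hdec (L / r ^ 2)
  rw [hcard, div_div, mul_comm (r ^ 2)] at h
  refine le_trans (measureReal_mono fun ω hω => ?_) h
  simp only [Set.mem_ofPred_eq, hrow] at hω ⊢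
  rw [le_div_iff₀ (by positivity)]
  refine le_trans ?_ hω
  rw [Finset.sum_mul]
  have e : ∀ j : {j // j ∉ I}, ((W ω).mulVec y j / r + -(μ * y j / r)) ^ 2 * r ^ 2 =
      ((W ω).mulVec y j - μ * y j) ^ 2 := by
    intro j; field_simp; ring
  simp_rw [e]
  rw [← Finset.sum_subtype (s := Iᶜ) (p := fun j => j ∉ I) (by simp)
    (fun j => ((W ω).mulVec y j - μ * y j) ^ 2)]
  exact Finset.sum_le_sum_of_subset_of_nonneg (Finset.subset_univ _) fun _ _ _ => sq_nonneg _

/-! ### Counting integer vectors -/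

/-- Counting by an exponential-moment argument: if every member of `F` has product weight at least
`c`, and the total weight of coordinate `i` is at most `S i`, then `F` has at most
`c⁻¹ * ∏ i, S i` members. -/
theorem card_mul_le_prod_of_weight {ι α : Type*} [Fintype ι] (w : ι → α → ℝ)
    (hw : ∀ i a, 0 ≤ w i a) (S : ι → ℝ) (hS : ∀ i (G : Finset α), ∑ a ∈ G, w i a ≤ S i)
    (F : Finset (ι → α)) (c : ℝ) (hF : ∀ z ∈ F, c ≤ ∏ i, w i (z i)) :
    F.card * c ≤ ∏ i, S i := by
  classical
  calc F.card * c = ∑ z ∈ F, c := by simp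
    _ ≤ ∑ z ∈ F, ∏ i, w i (z i) := Finset.sum_le_sum hF
    _ ≤ ∑ z ∈ Fintype.piFinset (fun i => F.image (· i)), ∏ i, w i (z i) := by
        refine Finset.sum_le_sum_of_subset_of_nonneg (fun z hz => ?_)
          fun _ _ _ => Finset.prod_nonneg fun i _ => hw _ _
        exact Fintype.mem_piFinset.2 fun i => Finset.mem_image_of_mem _ hz
    _ = ∏ i, ∑ a ∈ F.image (· i), w i a := (Finset.prod_univ_sum _ _).symm
    _ ≤ ∏ i, S i := Finset.prod_le_prod (fun i _ => Finset.sum_nonneg fun _ _ => hw _ _)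
        fun i _ => hS _ _

/-- The weight on the integers with value `1` at zero and `x * exp (-|z| / s)` elsewhere. -/
noncomputable def intWeight (x s : ℝ) (z : ℤ) : ℝ :=
  if z = 0 then 1 else x * Real.exp (-|(z : ℝ)| / s)

lemma intWeight_nonneg {x : ℝ} (hx : 0 ≤ x) (s : ℝ) (z : ℤ) : 0 ≤ intWeight x s z := by
  unfold intWeight; split_ifs <;> positivity

lemma sum_intWeight_le {x s : ℝ} (hx : 0 ≤ x) (hs : 0 < s) (G : Finset ℤ) :
    ∑ z ∈ G, intWeight x s z ≤ 1 + 2 * x * s := by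
  set q : ℝ := Real.exp (-1 / s) with hq
  have hq0 : 0 < q := Real.exp_pos _
  have hq1 : q < 1 := by
    rw [hq, Real.exp_lt_one_iff]; exact div_neg_of_neg_of_pos (by norm_num) hs
  have hqs : q / (1 - q) ≤ s := by
    rw [div_le_iff₀ (by linarith)]
    have h := Real.add_one_le_exp (1 / s)
    have hqi : q * Real.exp (1 / s) = 1 := by
      rw [hq, ← Real.exp_add]; simp [neg_div]
    have : q * (1 / s + 1) ≤ 1 := (mul_le_mul_of_nonneg_left h hq0.le).trans hqi.le
    have h2 : q * (1 + s) ≤ s := by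
      have := mul_le_mul_of_nonneg_right this hs.le
      rw [one_mul] at this
      refine le_trans (le_of_eq ?_) this
      field_simp
    linarith
  have hpow : ∀ n : ℕ, x * Real.exp (-((n : ℝ) + 1) / s) = x * q * q ^ n := by
    intro n
    rw [hq, ← Real.exp_nat_mul, mul_assoc, ← Real.exp_add]
    congr 2; field_simp; ring
  have hg := (hasSum_geometric_of_lt_one hq0.le hq1).mul_left (x * q)
  have h1 : HasSum (fun n : ℕ => intWeight x s (n : ℤ)) (1 + x * q * (1 - q)⁻¹) := by
    have : HasSum (fun n : ℕ => intWeight x s ((n + 1 : ℕ) : ℤ)) (x * q * (1 - q)⁻¹) := by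
      refine hg.congr_fun fun n => ?_
      unfold intWeight
      rw [if_neg (by positivity), ← hpow]
      congr 3
      push_cast
      rw [abs_of_nonneg (by positivity)]
    have := (hasSum_nat_add_iff (f := fun n : ℕ => intWeight x s (n : ℤ)) 1).1 this
    simpa [intWeight, add_comm] using this
  have h2 : HasSum (fun n : ℕ => intWeight x s (-(n + 1 : ℤ))) (x * q * (1 - q)⁻¹) := by
    refine hg.congr_fun fun n => ?_
    unfold intWeight
    rw [if_neg (by omega), ← hpow]
    congr 3
    push_cast
    rw [abs_neg, abs_of_nonneg (by positivity)]
  have h := h1.of_nat_of_neg_add_one h2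
  refine (sum_le_hasSum G (fun z _ => intWeight_nonneg hx s z) h).trans ?_
  have : x * q * (1 - q)⁻¹ ≤ x * s := by
    rw [mul_assoc, ← div_eq_mul_inv]; gcongr
  linarith

lemma abs_round_le (y : ℝ) : |(round y : ℝ)| ≤ 2 * |y| := by
  rcases eq_or_ne (round y) 0 with h | h
  · rw [h]; simp
  · have h1 : (1 : ℝ) ≤ |(round y : ℝ)| := by
      have := Int.one_le_abs h
      exact_mod_cast this
    have h2 := abs_sub_abs_le_abs_sub (round y : ℝ) y
    rw [abs_sub_comm] at h2
    have := abs_sub_round y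
    linarith

/-! ### The union bound over approximate eigenvectors -/

/-- Union bound. The set `T` of unit vectors is discretised by `code`: at most `N` values occur, and
vectors with equal codes are within `ρ` of each other. Choosing a representative in `T` of each
code and discretising the eigenvalue as well, a small-ball bound for fixed vectors of `T` bounds the
probability that some eigenvector lies in `T`. -/
theorem measureReal_exists_eigenvector_le {Ω C : Type*} [MeasurableSpace Ω] (P : Measure Ω)
    [IsProbabilityMeasure P] {n : ℕ} (hn : 0 < n) (W : Ω → Matrix (Fin n) (Fin n) ℝ)
    {M ρ N β : ℝ} (hM : 1 ≤ M) (hρ : 0 < ρ) (hρ1 : ρ ≤ 1) (T : Set (Fin n → ℝ))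
    (code : (Fin n → ℝ) → C) (hT : ∀ v ∈ T, ∑ i, v i ^ 2 = 1)
    (hcode : ∀ v ∈ T, ∀ v' ∈ T, code v = code v' → ∑ i, (v i - v' i) ^ 2 ≤ ρ ^ 2)
    (hN : ∀ F : Finset C, (∀ c ∈ F, ∃ v ∈ T, code v = c) → (F.card : ℝ) ≤ N)
    (hβ0 : 0 ≤ β) (hβ : ∀ y ∈ T, ∀ μ : ℝ,
      P.real {ω | ∑ j, ((W ω).mulVec y j - μ * y j) ^ 2 ≤ 11 * M ^ 2 * n * ρ ^ 2} ≤ β) :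
    P.real {ω | (∀ x : Fin n → ℝ, ∑ j, (W ω).mulVec x j ^ 2 ≤ M ^ 2 * n * ∑ i, x i ^ 2) ∧
      ∃ v ∈ T, ∃ lam : ℝ, ∀ j, (W ω).mulVec v j = lam * v j} ≤ N * ((2 * M / ρ + 2) * β) := by
  classical
  have hn' : (0 : ℝ) < n := by exact_mod_cast hn
  have hfin : (code '' T).Finite := by
    by_contra hinf
    obtain ⟨F, hF, hFc⟩ := Set.Infinite.exists_subset_card_eq hinf (⌊N⌋₊ + 1)
    have h1 := hN F (fun c hc => by
      obtain ⟨v, hv, h⟩ := hF hc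
      exact ⟨v, hv, h⟩)
    rw [hFc] at h1
    push_cast at h1
    have := Nat.lt_floor_add_one N
    linarith
  set Fc : Finset C := hfin.toFinset with hFc
  -- The net consists of members of `T` itself, so that `hβ` applies to it.
  have hrep : ∀ c : C, ∃ y : Fin n → ℝ, c ∈ Fc → y ∈ T ∧ code y = c := by
    intro c
    by_cases hc : c ∈ Fc
    · obtain ⟨v, hv, h⟩ := hfin.mem_toFinset.1 hc
      exact ⟨v, fun _ => ⟨hv, h⟩⟩
    · exact ⟨0, fun h => absurd h hc⟩
  choose rep hrep using hrep
  set m : ℕ := ⌊M / ρ + 1 / 2⌋₊ with hm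
  set Z : Finset ℤ := Finset.Icc (-(m : ℤ)) m with hZ
  set σ : ℝ := √(n : ℝ) * ρ with hσ
  have hσ0 : 0 < σ := by positivity
  have hσsq : σ ^ 2 = n * ρ ^ 2 := by rw [hσ, mul_pow, Real.sq_sqrt hn'.le]
  -- The eigenvalue is discretised with mesh `σ = √n ρ`, which costs `O(M / ρ)` values.
  have hcover : {ω | (∀ x : Fin n → ℝ, ∑ j, (W ω).mulVec x j ^ 2 ≤ M ^ 2 * n * ∑ i, x i ^ 2) ∧
      ∃ v ∈ T, ∃ lam : ℝ, ∀ j, (W ω).mulVec v j = lam * v j} ⊆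
      ⋃ c ∈ Fc, ⋃ z ∈ Z, {ω | ∑ j, ((W ω).mulVec (rep c) j - (z * σ) * rep c j) ^ 2 ≤
        11 * M ^ 2 * n * ρ ^ 2} := by
    rintro ω ⟨hnorm, v, hv, lam, hlam⟩
    have hv1 := hT v hv
    have hlam2 : lam ^ 2 ≤ M ^ 2 * n := by
      have := hnorm v
      simp_rw [hlam, mul_pow] at this
      rwa [← Finset.mul_sum, hv1, mul_one, mul_one] at this
    have hlam1 : |lam| ≤ M * √(n : ℝ) := by
      apply abs_le_of_sq_le_sq' _ (by positivity) |> abs_le.2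
      rw [mul_pow, Real.sq_sqrt hn'.le]; exact hlam2
    have hcmem : code v ∈ Fc := hfin.mem_toFinset.2 ⟨v, hv, rfl⟩
    obtain ⟨hyT, hyc⟩ := hrep (code v) hcmem
    set y := rep (code v) with hy
    have hd := hcode y hyT v hv hyc
    set z : ℤ := round (lam / σ) with hz
    have hround := abs_sub_round (lam / σ)
    have hlz : |lam - z * σ| ≤ σ / 2 := by
      have : lam - z * σ = (lam / σ - z) * σ := by field_simp
      rw [this, abs_mul, abs_of_pos hσ0]
      nlinarith
    have hzZ : z ∈ Z := by
      have h1 : |(z : ℝ)| ≤ M / ρ + 1 / 2 := by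
        have h2 : |lam / σ| ≤ M / ρ := by
          rw [abs_div, abs_of_pos hσ0, div_le_div_iff₀ hσ0 hρ, hσ]
          nlinarith
        have := abs_sub_abs_le_abs_sub (z : ℝ) (lam / σ)
        rw [abs_sub_comm] at this
        linarith
      have h2 : z.natAbs ≤ m := by
        apply Nat.le_floor
        rw [Nat.cast_natAbs]; push_cast; exact h1
      rw [hZ, Finset.mem_Icc]; omega
    simp only [Set.mem_iUnion]
    refine ⟨code v, hcmem, z, hzZ, ?_⟩
    simp only [Set.mem_ofPred_eq]
    rw [← hy]
    have hmu2 : (z * σ) ^ 2 ≤ (3 / 2 * M) ^ 2 * n := by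
      have h1 : |z * σ| ≤ 3 / 2 * M * √(n : ℝ) := by
        have h2 := abs_sub_abs_le_abs_sub (z * σ) lam
        rw [abs_sub_comm] at h2
        have h3 : σ ≤ M * √(n : ℝ) := by
          rw [hσ]; nlinarith [Real.sqrt_nonneg (n : ℝ)]
        linarith
      have := sq_le_sq' (by linarith [neg_abs_le (z * σ)]) ((le_abs_self _).trans h1)
      rwa [mul_pow (3 / 2 * M), Real.sq_sqrt hn'.le] at this
    have hlz2 : (lam - z * σ) ^ 2 ≤ n * ρ ^ 2 / 4 := by
      have := sq_le_sq' (by linarith [neg_abs_le (lam - z * σ)]) ((le_abs_self _).trans hlz)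
      rw [div_pow, hσsq] at this
      linarith
    -- Split off the exact eigenvector equation; the other two terms are errors of norm `O(M √n ρ)`.
    have hW : ∀ j, (W ω).mulVec y j - z * σ * y j =
        (W ω).mulVec (y - v) j - z * σ * (y j - v j) + (lam - z * σ) * v j := by
      intro j
      rw [Matrix.mulVec_sub, Pi.sub_apply, hlam]; ring
    have hWd := hnorm (y - v)
    simp only [Pi.sub_apply] at hWd
    calc ∑ j, ((W ω).mulVec y j - z * σ * y j) ^ 2
        ≤ ∑ j, 3 * ((W ω).mulVec (y - v) j ^ 2 + (z * σ) ^ 2 * (y j - v j) ^ 2 +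
          (lam - z * σ) ^ 2 * v j ^ 2) := by
          refine Finset.sum_le_sum fun j _ => ?_
          rw [hW]
          set a := (W ω).mulVec (y - v) j
          set b := z * σ * (y j - v j)
          set c := (lam - z * σ) * v j
          rw [← mul_pow, ← mul_pow]
          nlinarith [sq_nonneg (a + b), sq_nonneg (a - c), sq_nonneg (b + c)]
      _ = 3 * (∑ j, (W ω).mulVec (y - v) j ^ 2 + (z * σ) ^ 2 * ∑ j, (y j - v j) ^ 2 +
          (lam - z * σ) ^ 2 * ∑ j, v j ^ 2) := by
          rw [← Finset.mul_sum, Finset.sum_add_distrib, Finset.sum_add_distrib, Finset.mul_sum,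
            Finset.mul_sum]
      _ ≤ 3 * (M ^ 2 * n * ρ ^ 2 + (3 / 2 * M) ^ 2 * n * ρ ^ 2 + n * ρ ^ 2 / 4 * 1) := by
          rw [hv1]
          have : 0 ≤ ∑ j, (y j - v j) ^ 2 := Finset.sum_nonneg fun _ _ => sq_nonneg _
          have h1 : ∑ j, (W ω).mulVec (y - v) j ^ 2 ≤ M ^ 2 * n * ρ ^ 2 :=
            hWd.trans (by gcongr)
          have h2 : (z * σ) ^ 2 * ∑ j, (y j - v j) ^ 2 ≤ (3 / 2 * M) ^ 2 * n * ρ ^ 2 := by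
            gcongr
          linarith
      _ ≤ 11 * M ^ 2 * n * ρ ^ 2 := by
          have : n * ρ ^ 2 * 1 ≤ n * ρ ^ 2 * M ^ 2 := by gcongr; nlinarith
          nlinarith
  have hFcard : (Fc.card : ℝ) ≤ N := hN Fc fun c hc => by
    obtain ⟨v, hv, h⟩ := hfin.mem_toFinset.1 hc
    exact ⟨v, hv, h⟩
  have hZcard : (Z.card : ℝ) ≤ 2 * M / ρ + 2 := by
    have : Z.card = 2 * m + 1 := by rw [hZ, Int.card_Icc]; omega
    rw [this]; push_cast
    have h1 : (m : ℝ) ≤ M / ρ + 1 / 2 := Nat.floor_le (by positivity)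
    have : 2 * M / ρ = 2 * (M / ρ) := by ring
    linarith
  have hN0 : 0 ≤ N := le_trans (by positivity) hFcard
  calc _ ≤ P.real (⋃ c ∈ Fc, ⋃ z ∈ Z,
        {ω | ∑ j, ((W ω).mulVec (rep c) j - (z * σ) * rep c j) ^ 2 ≤ 11 * M ^ 2 * n * ρ ^ 2}) :=
        measureReal_mono hcover (measure_ne_top _ _)
    _ ≤ ∑ c ∈ Fc, P.real (⋃ z ∈ Z,
        {ω | ∑ j, ((W ω).mulVec (rep c) j - (z * σ) * rep c j) ^ 2 ≤ 11 * M ^ 2 * n * ρ ^ 2}) :=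
        measureReal_biUnion_finset_le _ _
    _ ≤ ∑ c ∈ Fc, ∑ z ∈ Z, β := by
        refine Finset.sum_le_sum fun c hc => (measureReal_biUnion_finset_le _ _).trans ?_
        exact Finset.sum_le_sum fun z _ => hβ _ (hrep c hc).1 _
    _ = Fc.card * (Z.card * β) := by simp
    _ ≤ _ := by gcongr

/-! ### Eigenvectors are not concentrated on few coordinates -/

/-- Unit vectors of which all but a fraction `δ` of the coordinates are small compared with the
typical size `1 / √n`. -/
def sparseVectors (n : ℕ) (ρ δ : ℝ) : Set (Fin n → ℝ) :=
  {v | ∑ i, v i ^ 2 = 1 ∧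
    ((Finset.univ.filter fun i => ρ / √(n : ℝ) / 2 ≤ |v i|).card : ℝ) ≤ δ * n}

lemma exists_half_mass {n : ℕ} (hn : 2 ≤ n) (y : Fin n → ℝ) (hy : ∑ i, y i ^ 2 = 1) :
    ∃ I : Finset (Fin n), 1 / 2 ≤ ∑ i ∈ I, y i ^ 2 ∧ (n : ℝ) / 3 ≤ ((n - I.card : ℕ) : ℝ) := by
  set I : Finset (Fin n) := Finset.univ.filter fun i => (i : ℕ) < n / 2 with hI
  have hc : I.card = n / 2 := by
    have : I = (Finset.range (n / 2)).attachFin (fun i hi => by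
        have := Finset.mem_range.1 hi; omega) := by
      ext i; simp [hI]
    rw [this, Finset.card_attachFin, Finset.card_range]
  have hcc : Iᶜ.card = n - n / 2 := by rw [Finset.card_compl, hc, Fintype.card_fin]
  have hs : ∑ i ∈ I, y i ^ 2 + ∑ i ∈ Iᶜ, y i ^ 2 = 1 := by
    rw [Finset.sum_add_sum_compl]; exact hy
  rcases le_total (1 / 2) (∑ i ∈ I, y i ^ 2) with h | h
  · refine ⟨I, h, ?_⟩
    rw [hc, div_le_iff₀ (by norm_num)]
    have : n ≤ (n - n / 2) * 3 := by omega
    exact_mod_cast this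
  · refine ⟨Iᶜ, by linarith, ?_⟩
    rw [hcc, div_le_iff₀ (by norm_num)]
    have : n ≤ (n - (n - n / 2)) * 3 := by omega
    exact_mod_cast this

lemma intWeight_exp_neg (b s : ℝ) (z : ℤ) :
    intWeight (Real.exp (-b)) s z = Real.exp (-((if z = 0 then 0 else b) + |(z : ℝ)| / s)) := by
  unfold intWeight
  split_ifs with h
  · simp [h]
  · rw [← Real.exp_add]; congr 1; ring

lemma sum_abs_round_div_le {n : ℕ} {v : Fin n → ℝ} (I : Finset (Fin n)) {R h : ℝ} (hR : 0 ≤ R)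
    (hv : ∑ i ∈ I, v i ^ 2 ≤ R ^ 2) (hh : 0 < h) :
    ∑ i ∈ I, |(round (v i / h) : ℝ)| ≤ 2 / h * (√(I.card : ℝ) * R) := by
  have h1 : ∑ i ∈ I, |(round (v i / h) : ℝ)| ≤ ∑ i ∈ I, 2 / h * |v i| := by
    refine Finset.sum_le_sum fun i _ => (abs_round_le _).trans (le_of_eq ?_)
    rw [abs_div, abs_of_pos hh]; ring
  rw [← Finset.mul_sum] at h1
  refine h1.trans ?_
  gcongr
  refine abs_le_of_sq_le_sq' ?_ (by positivity) |>.2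
  refine (sq_sum_le_card_mul_sum_sq (s := I) (f := fun i => |v i|)).trans ?_
  simp only [sq_abs]
  rw [mul_pow, Real.sq_sqrt (Nat.cast_nonneg _)]
  gcongr

lemma sum_sq_le_one {n : ℕ} {v : Fin n → ℝ} (hv : ∑ i, v i ^ 2 = 1) (I : Finset (Fin n)) :
    ∑ i ∈ I, v i ^ 2 ≤ 1 := by
  rw [← hv]
  exact Finset.sum_le_sum_of_subset_of_nonneg (Finset.subset_univ _) fun _ _ _ => sq_nonneg _

lemma sum_sub_sq_le_of_round_eq {n : ℕ} (hn : 0 < n) {ρ : ℝ} (hρ : 0 < ρ) (x x' : Fin n → ℝ)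
    (h : ∀ i, round (x i / (ρ / √(n : ℝ))) = round (x' i / (ρ / √(n : ℝ)))) :
    ∑ i, (x i - x' i) ^ 2 ≤ ρ ^ 2 := by
  have hn' : (0 : ℝ) < n := by exact_mod_cast hn
  have hs : 0 < √(n : ℝ) := Real.sqrt_pos.2 hn'
  have h1 : ∀ i, (x i - x' i) ^ 2 ≤ ρ ^ 2 / n := by
    intro i
    have a := abs_sub_round (x i / (ρ / √(n : ℝ)))
    have b := abs_sub_round (x' i / (ρ / √(n : ℝ)))
    rw [h i] at a
    rw [abs_sub_comm] at b
    have c := (abs_sub_le _ _ _).trans (add_le_add a b)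
    have d : |x i - x' i| ≤ ρ / √(n : ℝ) := by
      rw [← sub_div, abs_div, abs_of_pos (by positivity : 0 < ρ / √(n : ℝ)),
        div_le_iff₀ (by positivity)] at c
      linarith
    rw [← sq_abs, ← Real.sq_sqrt hn'.le, ← div_pow]
    gcongr
  refine (Finset.sum_le_sum fun i _ => h1 i).trans (le_of_eq ?_)
  simp; field_simp

/-- With exponentially high probability, no eigenvector is close to a sparse vector. The net of
sparse vectors has exponentially small growth rate, which a constant small-ball gain per row beats. -/
theorem exists_measureReal_sparse_eigenvector_le {ε p K M : ℝ} (hε : 0 < ε) (hp : 0 < p)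
    (hK : 0 < K) (hM : 1 ≤ M) :
    ∃ ρ δ c C : ℝ, 0 < ρ ∧ ρ ≤ 1 ∧ 0 < δ ∧ δ ≤ 1 ∧ 0 < c ∧ 0 < C ∧
      ∀ {Ω Ω₀ : Type*} [MeasurableSpace Ω] [MeasurableSpace Ω₀] (P : Measure Ω)
        [IsProbabilityMeasure P] (P₀ : Measure Ω₀) (n : ℕ) (W : Ω → Matrix (Fin n) (Fin n) ℝ)
        (ξ ζ : Ω₀ → ℝ) [IsProbabilityMeasure (P₀.map ξ)], HasSpread (P₀.map ξ) ε p K →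
        IsWigner P P₀ W ξ ζ → 2 ≤ n →
        P.real {ω | (∀ x : Fin n → ℝ, ∑ j, (W ω).mulVec x j ^ 2 ≤ M ^ 2 * n * ∑ i, x i ^ 2) ∧
          ∃ v ∈ sparseVectors n ρ δ, ∃ lam : ℝ, ∀ j, (W ω).mulVec v j = lam * v j} ≤
        C * Real.exp (-c * n) := by
  obtain ⟨g, hg0, hg1, hg⟩ := exists_gaussAvg_le hε hp hK
  set a : ℝ := -Real.log g with ha
  have ha0 : 0 < a := by rw [ha]; linarith [Real.log_neg hg0 hg1]
  have hga : g = Real.exp (-a) := by rw [ha, neg_neg, Real.exp_log hg0]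
  -- A fixed vector gains `exp (-a n / 3)`. The mesh `ρ` is chosen so that the approximation error
  -- costs `exp (a n / 12)`, and then `b` and `δ` so that there are at most `exp (a n / 8)` codes.
  obtain ⟨ρ, hρ0, hρ1, hρ⟩ : ∃ ρ : ℝ, 0 < ρ ∧ ρ ≤ 1 ∧ 11 * M ^ 2 * ρ ^ 2 ≤ 2 * K ^ 2 * (a / 12) := by
    refine ⟨min 1 (K * √(a / 66) / M), by positivity, min_le_left _ _, ?_⟩
    have h1 : min 1 (K * √(a / 66) / M) ^ 2 ≤ (K * √(a / 66) / M) ^ 2 := by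
      gcongr; exact min_le_right _ _
    have h2 : (K * √(a / 66) / M) ^ 2 = K ^ 2 * (a / 66) / M ^ 2 := by
      rw [div_pow, mul_pow, Real.sq_sqrt (by positivity)]
    rw [h2, le_div_iff₀ (by positivity)] at h1
    nlinarith
  set b : ℝ := 48 / a with hb
  have hb0 : 0 < b := by positivity
  have heb : 2 * Real.exp (-b) ≤ a / 24 := by
    have h1 := Real.add_one_le_exp b
    have h2 : Real.exp (-b) ≤ 1 / b := by
      rw [Real.exp_neg, ← one_div]; gcongr; linarith
    have : 1 / b = a / 48 := by rw [hb]; field_simp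
    linarith
  obtain ⟨δ, hδ0, hδ1, hδ2, hδ3⟩ : ∃ δ : ℝ, 0 < δ ∧ δ ≤ 1 ∧ b * δ ≤ a / 24 ∧
      2 * √δ / ρ ≤ a / 24 := by
    refine ⟨min 1 (min (a / 24 / b) ((a * ρ / 48) ^ 2)), by positivity, min_le_left _ _, ?_, ?_⟩
    · have : min 1 (min (a / 24 / b) ((a * ρ / 48) ^ 2)) ≤ a / 24 / b :=
        (min_le_right _ _).trans (min_le_left _ _)
      rwa [le_div_iff₀ hb0, mul_comm] at this
    · have : √(min 1 (min (a / 24 / b) ((a * ρ / 48) ^ 2))) ≤ a * ρ / 48 := by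
        apply Real.sqrt_le_iff.2 ⟨by positivity, (min_le_right _ _).trans (min_le_right _ _)⟩
      rw [div_le_iff₀ hρ0]; linarith
  refine ⟨ρ, δ, a / 8, 2 * M / ρ + 2, hρ0, hρ1, hδ0, hδ1, by positivity, by positivity, ?_⟩
  intro Ω Ω₀ _ _ P _ P₀ n W ξ ζ _ hν hW hn
  have hn0 : 0 < n := by omega
  have hn' : (0 : ℝ) < n := by exact_mod_cast hn0
  have hs : 0 < √(n : ℝ) := Real.sqrt_pos.2 hn'
  set h : ℝ := ρ / √(n : ℝ) with hh
  have hh0 : 0 < h := by positivity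
  have main := measureReal_exists_eigenvector_le P hn0 W hM hρ0 hρ1 (sparseVectors n ρ δ)
    (fun v i => round (v i / h)) (N := Real.exp (a / 8 * n)) (β := Real.exp (-(a / 4) * n))
    (fun v hv => hv.1) (fun v _ v' _ he =>
      sum_sub_sq_le_of_round_eq hn0 hρ0 v v' fun i => congrFun he i) ?_ (Real.exp_pos _).le ?_
  · refine main.trans (le_of_eq ?_)
    rw [mul_comm (2 * M / ρ + 2), ← mul_assoc, ← Real.exp_add, mul_comm]
    congr 2; ring
  · intro F hF
    have hcount := card_mul_le_prod_of_weight (fun (_ : Fin n) z => intWeight (Real.exp (-b)) 1 z)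
      (fun _ z => intWeight_nonneg (Real.exp_pos _).le _ z) (fun _ => 1 + 2 * Real.exp (-b) * 1)
      (fun _ G => sum_intWeight_le (Real.exp_pos _).le one_pos G) F
      (Real.exp (-(a / 12 * n))) (by
        intro z hz
        obtain ⟨v, ⟨hv1, hv2⟩, rfl⟩ := hF z hz
        simp only [intWeight_exp_neg, div_one]
        rw [← Real.exp_sum, Real.exp_le_exp, Finset.sum_neg_distrib, neg_le_neg_iff,
          Finset.sum_add_distrib]
        set S := Finset.univ.filter fun i => ρ / √(n : ℝ) / 2 ≤ |v i| with hS
        -- The mesh is such that coordinates outside the large set `S` are rounded to zero.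
        have hz0 : ∀ i, i ∉ S → round (v i / h) = 0 := by
          intro i hi
          simp only [hS, Finset.mem_filter, Finset.mem_univ, true_and, not_le, ← hh] at hi
          rw [round_eq_zero_iff, Set.mem_Ico]
          have := abs_lt.1 hi
          rw [le_div_iff₀ hh0, div_lt_iff₀ hh0]
          constructor <;> linarith
        have h1 : ∑ i, (if round (v i / h) = 0 then 0 else b) ≤ b * (δ * n) := by
          calc ∑ i, (if round (v i / h) = 0 then 0 else b)
              = ∑ i ∈ S, (if round (v i / h) = 0 then 0 else b) := by
                symm
                refine Finset.sum_subset (Finset.subset_univ _) fun i _ hi => ?_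
                rw [if_pos (hz0 i hi)]
            _ ≤ ∑ i ∈ S, b := by
                refine Finset.sum_le_sum fun i _ => ?_
                split_ifs <;> linarith
            _ = b * S.card := by simp [mul_comm]
            _ ≤ _ := by gcongr
        have h2 : ∑ i, |(round (v i / h) : ℝ)| ≤ 2 * √δ / ρ * n := by
          calc ∑ i, |(round (v i / h) : ℝ)| = ∑ i ∈ S, |(round (v i / h) : ℝ)| := by
                symm
                refine Finset.sum_subset (Finset.subset_univ _) fun i _ hi => ?_
                rw [hz0 i hi]; simp
            _ ≤ 2 / h * (√(S.card : ℝ) * 1) := sum_abs_round_div_le S zero_le_one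
                (by rw [one_pow]; exact sum_sq_le_one hv1 S) hh0
            _ ≤ 2 / h * √(δ * n) := by rw [mul_one]; gcongr
            _ = 2 * √δ / ρ * (√(n : ℝ) * √(n : ℝ)) := by
                rw [Real.sqrt_mul hδ0.le, hh]; field_simp
            _ = _ := by rw [Real.mul_self_sqrt hn'.le]
        have h3 : b * (δ * n) ≤ a / 24 * n := by rw [← mul_assoc]; gcongr
        have h4 : 2 * √δ / ρ * n ≤ a / 24 * n := by gcongr
        linarith)
    have hprod : ∏ _i : Fin n, (1 + 2 * Real.exp (-b) * 1) ≤ Real.exp (a / 24 * n) := by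
      rw [Finset.prod_const, Finset.card_univ, Fintype.card_fin, mul_comm (a / 24),
        Real.exp_nat_mul]
      gcongr
      have := Real.add_one_le_exp (a / 24)
      linarith
    have : (F.card : ℝ) = F.card * Real.exp (-(a / 12 * n)) * Real.exp (a / 12 * n) := by
      rw [mul_assoc, ← Real.exp_add]; simp
    rw [this]
    calc _ ≤ Real.exp (a / 24 * n) * Real.exp (a / 12 * n) := by
          gcongr; exact hcount.trans hprod
      _ = _ := by rw [← Real.exp_add]; congr 1; ring
  · intro y hy μ
    obtain ⟨I, hI1, hI2⟩ := exists_half_mass hn y hy.1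
    have hy1 : ∀ i ∈ I, |y i| ≤ 1 := by
      intro i _
      rw [abs_le_one_iff_mul_self_le_one, ← sq, ← hy.1]
      exact Finset.single_le_sum (f := fun i => y i ^ 2) (fun _ _ => sq_nonneg _)
        (Finset.mem_univ i)
    refine (hW.measureReal_sum_sq_le I y μ K _ hK).trans ?_
    have h1 : gaussAvg (P₀.map ξ) I (fun i => y i / K) ^ (n - I.card) ≤
        Real.exp (-(a / 3 * n)) := by
      calc _ ≤ g ^ (n - I.card) := by
            gcongr
            · exact gaussAvg_nonneg _ _ _
            · exact hg _ hν I y hy1 hI1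
        _ = Real.exp (((n - I.card : ℕ) : ℝ) * (-a)) := by rw [Real.exp_nat_mul, ← hga]
        _ ≤ _ := Real.exp_le_exp.2 (by nlinarith)
    have h2 : Real.exp (11 * M ^ 2 * n * ρ ^ 2 / (2 * K ^ 2)) ≤ Real.exp (a / 12 * n) := by
      apply Real.exp_le_exp.2
      rw [div_le_iff₀ (by positivity)]
      have := mul_le_mul_of_nonneg_right hρ hn'.le
      linarith
    calc _ ≤ Real.exp (a / 12 * n) * Real.exp (-(a / 3 * n)) := by
          gcongr; exact pow_nonneg (gaussAvg_nonneg _ _ _) _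
      _ = _ := by rw [← Real.exp_add]; congr 1; ring

/-! ### Eigenvectors close to rational vectors -/

/-- The coordinates that `π` assigns to the block `a`; coordinates with `π i = none` lie in no
block. -/
def block {n k : ℕ} (π : Fin n → Option (Fin k)) (a : Fin k) : Finset (Fin n) :=
  Finset.univ.filter fun i => π i = some a

/-- Unit vectors whose coordinates in the blocks of `π` have the typical order of magnitude
`1 / √n`. -/
def spreadVectors {n k : ℕ} (lo hi : ℝ) (π : Fin n → Option (Fin k)) : Set (Fin n → ℝ) :=
  {v | ∑ i, v i ^ 2 = 1 ∧ ∀ i a, π i = some a → lo / √(n : ℝ) ≤ |v i| ∧ |v i| ≤ hi / √(n : ℝ)}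

/-- Spread vectors for which every block `a` is close to a rational vector with denominator
`Θ a ≤ 2 D`, while the block `a₀` has no approximation with a denominator up to `D`. -/
def rationalVectors {n k : ℕ} (lo hi η κ D : ℝ) (π : Fin n → Option (Fin k)) (a₀ : Fin k)
    (Θ : Fin k → ℕ) : Set (Fin n → ℝ) :=
  {v | v ∈ spreadVectors lo hi π ∧ FarFromLattice (block π a₀) η κ D v ∧
    ∀ a, √(n : ℝ) / (2 * hi) ≤ Θ a ∧ (Θ a : ℝ) ≤ 2 * D ∧
      latDistSq (block π a) (fun i => Θ a * v i) ≤ 4 * κ ^ 2}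

/-- The weight used to count codes: the first component is confined to `[-B, B]`, and the second one
decays at scale `s`. -/
noncomputable def codeWeight (B s : ℝ) (z : ℤ × ℤ) : ℝ :=
  (if |(z.1 : ℝ)| ≤ B then 1 else 0) * intWeight 1 s z.2

lemma codeWeight_nonneg (B s : ℝ) (z : ℤ × ℤ) : 0 ≤ codeWeight B s z := by
  unfold codeWeight
  have := intWeight_nonneg zero_le_one s z.2
  split_ifs <;> simp [this]

lemma sum_codeWeight_le {B s : ℝ} (hB : 0 ≤ B) (hs : 0 < s) (G : Finset (ℤ × ℤ)) :
    ∑ z ∈ G, codeWeight B s z ≤ (2 * B + 1) * (1 + 2 * s) := by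
  classical
  have h1 : ∑ p ∈ G.image Prod.fst, (if |(p : ℝ)| ≤ B then (1 : ℝ) else 0) ≤ 2 * B + 1 := by
    rw [Finset.sum_ite, Finset.sum_const_zero, add_zero, Finset.sum_const, nsmul_eq_mul, mul_one]
    have hsub : (G.image Prod.fst).filter (fun p : ℤ => |(p : ℝ)| ≤ B) ⊆
        Finset.Icc (-(⌊B⌋₊ : ℤ)) ⌊B⌋₊ := by
      intro p hp
      have h2 : p.natAbs ≤ ⌊B⌋₊ := by
        apply Nat.le_floor
        rw [Nat.cast_natAbs]; push_cast; exact (Finset.mem_filter.1 hp).2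
      rw [Finset.mem_Icc]; omega
    have h3 := Finset.card_le_card hsub
    have h4 : (Finset.Icc (-(⌊B⌋₊ : ℤ)) ⌊B⌋₊).card = 2 * ⌊B⌋₊ + 1 := by
      rw [Int.card_Icc]; omega
    rw [h4] at h3
    have h5 : ((((G.image Prod.fst).filter (fun p : ℤ => |(p : ℝ)| ≤ B)).card : ℕ) : ℝ) ≤
      ((2 * ⌊B⌋₊ + 1 : ℕ) : ℝ) := by exact_mod_cast h3
    push_cast at h5
    linarith [Nat.floor_le hB]
  have h2 := sum_intWeight_le zero_le_one hs (G.image Prod.snd)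
  calc ∑ z ∈ G, codeWeight B s z
      ≤ ∑ z ∈ (G.image Prod.fst) ×ˢ (G.image Prod.snd), codeWeight B s z := by
        refine Finset.sum_le_sum_of_subset_of_nonneg (fun z hz => ?_)
          fun z _ _ => codeWeight_nonneg B s z
        exact Finset.mem_product.2 ⟨Finset.mem_image_of_mem _ hz, Finset.mem_image_of_mem _ hz⟩
    _ = (∑ p ∈ G.image Prod.fst, (if |(p : ℝ)| ≤ B then (1 : ℝ) else 0)) *
        ∑ q ∈ G.image Prod.snd, intWeight 1 s q := by
        rw [Finset.sum_mul_sum, Finset.sum_product]; rfl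
    _ ≤ _ := by
        gcongr
        · exact Finset.sum_nonneg fun q _ => intWeight_nonneg zero_le_one s q
        · linarith

/-- The code of a vector: numerators `p` of the rational approximation with denominators `Θ`, and
the residual, rounded to the mesh `h`. Outside the blocks only the rounding is used. -/
noncomputable def rationalCode {n k : ℕ} (π : Fin n → Option (Fin k)) (Θ : Fin k → ℕ) (h : ℝ)
    (v : Fin n → ℝ) (i : Fin n) : ℤ × ℤ :=
  match π i with
  | none => (0, round (v i / h))
  | some a => (round (Θ a * v i), round ((v i - round (Θ a * v i) / Θ a) / h))

lemma sum_eq_sum_none_add_sum_block {n k : ℕ} (π : Fin n → Option (Fin k)) (f : Fin n → ℝ) :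
    ∑ i, f i = ∑ i ∈ Finset.univ.filter (fun i => π i = none), f i +
      ∑ a, ∑ i ∈ block π a, f i := by
  have := Finset.sum_fiberwise Finset.univ π f
  rw [← this, Fintype.sum_option]
  rfl

lemma prod_eq_prod_none_mul_prod_block {n k : ℕ} (π : Fin n → Option (Fin k)) (f : Fin n → ℝ) :
    ∏ i, f i = (∏ i ∈ Finset.univ.filter (fun i => π i = none), f i) *
      ∏ a, ∏ i ∈ block π a, f i := by
  have := Finset.prod_fiberwise Finset.univ π f
  rw [← this, Fintype.prod_option]
  rfl

/-- The number of codes of vectors in `rationalVectors`. The factor `√n ^ (k * m)` in the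
denominator, which reflects that integer vectors of norm `D` in dimension `m` number about
`(C * D / √m) ^ m`, is the source of the whole gain. -/
lemma card_rationalCode_le {n k m : ℕ} (hn : 0 < n) {lo hi η κ D : ℝ} (hhi : 1 ≤ hi) (hκ : 1 ≤ κ)
    (hD : 1 ≤ D) (π : Fin n → Option (Fin k)) (hπ : ∀ a, (block π a).card = m) (a₀ : Fin k)
    (Θ : Fin k → ℕ) (F : Finset (Fin n → ℤ × ℤ))
    (hF : ∀ c ∈ F, ∃ v ∈ rationalVectors lo hi η κ D π a₀ Θ,
      rationalCode π Θ (κ / D / √(n : ℝ)) v = c) :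
    (F.card : ℝ) ≤ Real.exp ((4 * k + 2) * n) * ((24 * hi * D) ^ n / √(n : ℝ) ^ (k * m)) := by
  rcases F.eq_empty_or_nonempty with rfl | ⟨c₀, hc₀⟩
  · simp; positivity
  have hn' : (0 : ℝ) < n := by exact_mod_cast hn
  have hs : 0 < √(n : ℝ) := Real.sqrt_pos.2 hn'
  have hss : √(n : ℝ) * √(n : ℝ) = n := Real.mul_self_sqrt hn'.le
  have hs1 : 1 ≤ √(n : ℝ) := by
    rw [Real.one_le_sqrt]; exact_mod_cast hn
  have hD0 : 0 < D := by linarith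
  have hκ0 : 0 < κ := by linarith
  set h : ℝ := κ / D / √(n : ℝ) with hh
  have hh0 : 0 < h := by positivity
  have hΘ1 : ∀ a, √(n : ℝ) ≤ 2 * hi * Θ a := by
    intro a
    obtain ⟨v, hv, -⟩ := hF c₀ hc₀
    have := (hv.2.2 a).1
    rwa [div_le_iff₀ (by positivity), mul_comm] at this
  have hΘ2 : ∀ a, (Θ a : ℝ) ≤ 2 * D := by
    intro a
    obtain ⟨v, hv, -⟩ := hF c₀ hc₀
    exact (hv.2.2 a).2.1
  have hΘ0 : ∀ a, (0 : ℝ) < Θ a := by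
    intro a
    have := hΘ1 a
    by_contra hc
    have : 2 * hi * (Θ a : ℝ) ≤ 0 := mul_nonpos_of_nonneg_of_nonpos (by positivity) (not_lt.1 hc)
    linarith
  set B : Fin n → ℝ := fun i => (π i).elim 0 fun a => 2 * Θ a * hi / √(n : ℝ) with hB
  set s : Fin n → ℝ := fun i => (π i).elim D fun a => D / Θ a with hsdef
  have hB0 : ∀ i, 0 ≤ B i := by
    intro i; simp only [hB]; cases π i <;> simp only [Option.elim] <;> positivity
  have hspos : ∀ i, 0 < s i := by
    intro i; simp only [hsdef]
    cases hp : π i with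
    | none => simpa using hD0
    | some a => simp only [Option.elim]; have := hΘ0 a; positivity
  have hcount := card_mul_le_prod_of_weight (fun i z => codeWeight (B i) (s i) z)
    (fun i z => codeWeight_nonneg _ _ z) (fun i => (2 * B i + 1) * (1 + 2 * s i))
    (fun i G => sum_codeWeight_le (hB0 i) (hspos i) G) F (Real.exp (-((4 * k + 2) * n))) (by
      intro z hz
      obtain ⟨v, ⟨⟨hv1, hv2⟩, -, hv3⟩, rfl⟩ := hF z hz
      have hw : ∀ i, codeWeight (B i) (s i) (rationalCode π Θ h v i) =
          Real.exp (-(|((rationalCode π Θ h v i).2 : ℝ)| / s i)) := by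
        intro i
        have hle : |((rationalCode π Θ h v i).1 : ℝ)| ≤ B i := by
          simp only [rationalCode, hB]
          cases hp : π i with
          | none => simp
          | some a =>
            simp only [Option.elim]
            refine (abs_round_le _).trans ?_
            rw [abs_mul, Nat.abs_cast]
            have := (hv2 i a hp).2
            calc 2 * ((Θ a : ℝ) * |v i|) ≤ 2 * (Θ a * (hi / √(n : ℝ))) := by gcongr
              _ = _ := by ring
        unfold codeWeight
        rw [if_pos hle, one_mul]
        have := intWeight_exp_neg 0 (s i) (rationalCode π Θ h v i).2
        simpa using this
      simp_rw [hw]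
      rw [← Real.exp_sum, Real.exp_le_exp, Finset.sum_neg_distrib, neg_le_neg_iff,
        sum_eq_sum_none_add_sum_block π]
      have h1 : ∑ i ∈ Finset.univ.filter (fun i => π i = none),
          |((rationalCode π Θ h v i).2 : ℝ)| / s i ≤ 2 * n := by
        calc _ = (∑ i ∈ Finset.univ.filter (fun i => π i = none), |(round (v i / h) : ℝ)|) / D := by
              rw [Finset.sum_div]
              refine Finset.sum_congr rfl fun i hi => ?_
              have hp : π i = none := (Finset.mem_filter.1 hi).2
              simp [rationalCode, hsdef, hp]
          _ ≤ 2 / h * (√((Finset.univ.filter (fun i => π i = none)).card : ℝ) * 1) / D := by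
              gcongr
              exact sum_abs_round_div_le _ zero_le_one
                (by rw [one_pow]; exact sum_sq_le_one hv1 _) hh0
          _ ≤ 2 / h * (√(n : ℝ) * 1) / D := by
              gcongr
              exact (Finset.card_le_univ _).trans_eq (Fintype.card_fin n)
          _ = 2 * (√(n : ℝ) * √(n : ℝ)) / κ := by rw [hh]; field_simp
          _ ≤ _ := by
              rw [hss, div_le_iff₀ hκ0]; nlinarith
      have h2 : ∀ a, ∑ i ∈ block π a, |((rationalCode π Θ h v i).2 : ℝ)| / s i ≤ 4 * n := by
        intro a
        have ha := hΘ0 a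
        calc _ = (∑ i ∈ block π a, |(round ((v i - round (Θ a * v i) / Θ a) / h) : ℝ)|) /
                (D / Θ a) := by
              rw [Finset.sum_div]
              refine Finset.sum_congr rfl fun i hi => ?_
              have hp : π i = some a := (Finset.mem_filter.1 hi).2
              simp [rationalCode, hsdef, hp]
          _ ≤ 2 / h * (√((block π a).card : ℝ) * (2 * κ / Θ a)) / (D / Θ a) := by
              gcongr
              refine sum_abs_round_div_le (v := fun i => v i - round (Θ a * v i) / Θ a)
                _ (by positivity) ?_ hh0
              have h3 := (hv3 a).2.2
              have e : ∑ i ∈ block π a, (v i - round (Θ a * v i) / Θ a) ^ 2 =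
                  latDistSq (block π a) (fun i => Θ a * v i) / Θ a ^ 2 := by
                rw [latDistSq, Finset.sum_div]
                refine Finset.sum_congr rfl fun i _ => ?_
                field_simp
              rw [e, div_pow]
              gcongr
              linarith
          _ ≤ 2 / h * (√(n : ℝ) * (2 * κ / Θ a)) / (D / Θ a) := by
              gcongr
              exact (Finset.card_le_univ _).trans_eq (Fintype.card_fin n)
          _ = 4 * (√(n : ℝ) * √(n : ℝ)) := by rw [hh]; field_simp; ring
          _ = _ := by rw [hss]
      have h3 := Finset.sum_le_sum fun a (_ : a ∈ (Finset.univ : Finset (Fin k))) => h2 a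
      simp only [Finset.sum_const, Finset.card_univ, Fintype.card_fin, nsmul_eq_mul] at h3
      linarith)
  have hprod : ∏ i, ((2 * B i + 1) * (1 + 2 * s i)) ≤ (24 * hi * D) ^ n / √(n : ℝ) ^ (k * m) := by
    calc ∏ i, ((2 * B i + 1) * (1 + 2 * s i))
        ≤ ∏ i, (24 * hi * D * (π i).elim 1 fun _ => (√(n : ℝ))⁻¹) := by
          refine Finset.prod_le_prod (fun i _ => ?_) fun i _ => ?_
          · have := hB0 i; have := hspos i; positivity
          · simp only [hB, hsdef]
            cases hp : π i with
            | none =>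
              simp only [Option.elim]
              nlinarith
            | some a =>
              simp only [Option.elim]
              have ha := hΘ0 a
              -- Both ranges are at least of order one, so that the additive constants are absorbed
              -- and the denominators `Θ a` cancel.
              have e1 : 1 ≤ 2 * Θ a * hi / √(n : ℝ) := by
                rw [le_div_iff₀ hs]; linarith [hΘ1 a]
              have e2 : 1 ≤ 2 * (D / Θ a) := by
                rw [← mul_div_assoc, le_div_iff₀ ha]; linarith [hΘ2 a]
              calc _ ≤ (3 * (2 * Θ a * hi / √(n : ℝ))) * (2 * (2 * (D / Θ a))) := by
                    gcongr <;> linarith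
                _ = _ := by field_simp; ring
      _ = _ := by
          rw [Finset.prod_mul_distrib, Finset.prod_const, Finset.card_univ, Fintype.card_fin,
            div_eq_mul_inv]
          congr 1
          rw [prod_eq_prod_none_mul_prod_block π]
          have e1 : ∏ i ∈ Finset.univ.filter (fun i => π i = none),
              ((π i).elim 1 fun _ => (√(n : ℝ))⁻¹) = 1 := by
            refine Finset.prod_eq_one fun i hi => ?_
            have hp : π i = none := (Finset.mem_filter.1 hi).2
            simp [hp]
          have e2 : ∀ a, ∏ i ∈ block π a, ((π i).elim 1 fun _ => (√(n : ℝ))⁻¹) =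
              (√(n : ℝ))⁻¹ ^ m := by
            intro a
            rw [← hπ a, ← Finset.prod_const]
            refine Finset.prod_congr rfl fun i hi => ?_
            have hp : π i = some a := (Finset.mem_filter.1 hi).2
            simp [hp]
          rw [e1, one_mul, Finset.prod_congr rfl fun a _ => e2 a, Finset.prod_const,
            Finset.card_univ, Fintype.card_fin, ← pow_mul, inv_pow, mul_comm m k]
  have : (F.card : ℝ) = Real.exp ((4 * k + 2) * n) *
      (F.card * Real.exp (-((4 * k + 2) * n))) := by
    rw [mul_comm, mul_assoc, ← Real.exp_add]; simp
  rw [this]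
  gcongr
  exact hcount.trans hprod

lemma rationalCode_close {n k : ℕ} (hn : 0 < n) {ρ : ℝ} (hρ : 0 < ρ)
    (π : Fin n → Option (Fin k)) (Θ : Fin k → ℕ) (v v' : Fin n → ℝ)
    (h : rationalCode π Θ (ρ / √(n : ℝ)) v = rationalCode π Θ (ρ / √(n : ℝ)) v') :
    ∑ i, (v i - v' i) ^ 2 ≤ ρ ^ 2 := by
  set f : (Fin n → ℝ) → Fin n → ℝ := fun v i =>
    (π i).elim (0 : ℝ) fun a => (round (Θ a * v i) : ℝ) / Θ a with hf
  have key : ∀ i, f v i = f v' i ∧ round ((v i - f v i) / (ρ / √(n : ℝ))) =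
      round ((v' i - f v' i) / (ρ / √(n : ℝ))) := by
    intro i
    have hi := congrFun h i
    simp only [rationalCode] at hi
    simp only [hf]
    cases hp : π i with
    | none => rw [hp] at hi; simpa using hi
    | some a =>
      rw [hp] at hi
      simp only [Prod.mk.injEq] at hi
      simp only [Option.elim]
      exact ⟨by rw [hi.1], hi.2⟩
  have := sum_sub_sq_le_of_round_eq hn hρ (fun i => v i - f v i) (fun i => v' i - f v' i)
    fun i => (key i).2
  refine le_trans (le_of_eq ?_) this
  refine Finset.sum_congr rfl fun i _ => ?_
  rw [(key i).1]; ring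

/-- The probability that some eigenvector belongs to a given class of rational vectors. -/
theorem IsWigner.measureReal_rational_eigenvector_le {Ω Ω₀ : Type*} [MeasurableSpace Ω]
    [MeasurableSpace Ω₀] {P : Measure Ω} [IsProbabilityMeasure P] {P₀ : Measure Ω₀} {n : ℕ}
    {W : Ω → Matrix (Fin n) (Fin n) ℝ} {ξ ζ : Ω₀ → ℝ} (hW : IsWigner P P₀ W ξ ζ)
    [IsProbabilityMeasure (P₀.map ξ)] {ε p K M : ℝ} (hε : 0 < ε) (hp : 0 < p)
    (hK : 0 < K) (hM : 1 ≤ M) (hν : HasSpread (P₀.map ξ) ε p K) (hn : 0 < n)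
    {k m : ℕ} (hm : m ≤ n) {lo hi η κ D : ℝ} (hhi : 1 ≤ hi) (hη : 0 < η) (hκ : 1 ≤ κ) (hκD : κ ≤ D)
    (htail : Real.exp (-2 * p * κ ^ 2) + 2 * Real.exp (-κ ^ 2 / 4) ≤ 1 / D)
    (π : Fin n → Option (Fin k)) (hπ : ∀ a, (block π a).card = m) (a₀ : Fin k) (Θ : Fin k → ℕ) :
    P.real {ω | (∀ x : Fin n → ℝ, ∑ j, (W ω).mulVec x j ^ 2 ≤ M ^ 2 * n * ∑ i, x i ^ 2) ∧
      ∃ v ∈ rationalVectors lo hi η κ D π a₀ Θ, ∃ lam : ℝ, ∀ j, (W ω).mulVec v j = lam * v j} ≤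
      4 * M * (Real.exp (4 * k + 2 + 11 * M ^ 2 / (2 * K ^ 2)) * (24 * hi) *
        (4 * K / (√p * η * ε) + 1)) ^ n * κ ^ n * D ^ (m + 1) / √(n : ℝ) ^ (k * m) := by
  have hn' : (0 : ℝ) < n := by exact_mod_cast hn
  have hs : 0 < √(n : ℝ) := Real.sqrt_pos.2 hn'
  have hκ0 : 0 < κ := by linarith
  have hD0 : 0 < D := by linarith
  have hsp : 0 < √p := Real.sqrt_pos.2 hp
  set H : ℝ := 4 * K / (√p * η * ε) + 1 with hH
  have hH1 : 1 ≤ H := by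
    have : 0 ≤ 4 * K / (√p * η * ε) := by positivity
    linarith
  have main := measureReal_exists_eigenvector_le P hn W hM (ρ := κ / D) (by positivity)
    ((div_le_one hD0).2 hκD) (rationalVectors lo hi η κ D π a₀ Θ)
    (rationalCode π Θ (κ / D / √(n : ℝ)))
    (N := Real.exp ((4 * k + 2) * n) * ((24 * hi * D) ^ n / √(n : ℝ) ^ (k * m)))
    (β := Real.exp (11 * M ^ 2 / (2 * K ^ 2) * n) * (H * κ / D) ^ (n - m))
    (fun v hv => hv.1.1) (fun v _ v' _ he => rationalCode_close hn (by positivity) π Θ v v' he)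
    (fun F hF => card_rationalCode_le hn hhi hκ (by linarith) π hπ a₀ Θ F hF) (by positivity) ?_
  · refine main.trans ?_
    have h1 : 2 * M / (κ / D) + 2 ≤ 4 * M * D := by
      have : 2 * M / (κ / D) ≤ 2 * M * D := by
        rw [div_div_eq_mul_div, div_le_iff₀ hκ0]
        have : 0 ≤ 2 * M * D := by positivity
        nlinarith
      nlinarith
    have h2 : (H * κ / D) ^ (n - m) ≤ (H * κ) ^ n * D ^ m / D ^ n := by
      have e : D ^ n = D ^ (n - m) * D ^ m := by rw [← pow_add]; congr 1; omega
      have e' : (H * κ) ^ (n - m) ≤ (H * κ) ^ n := pow_le_pow_right₀ (by nlinarith) (by omega)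
      rw [div_pow, e, div_le_div_iff₀ (by positivity) (by positivity)]
      calc (H * κ) ^ (n - m) * (D ^ (n - m) * D ^ m) ≤ (H * κ) ^ n * (D ^ (n - m) * D ^ m) := by
            gcongr
        _ = _ := by ring
    calc _ ≤ Real.exp ((4 * k + 2) * n) * ((24 * hi * D) ^ n / √(n : ℝ) ^ (k * m)) *
          (4 * M * D * (Real.exp (11 * M ^ 2 / (2 * K ^ 2) * n) *
            ((H * κ) ^ n * D ^ m / D ^ n))) := by gcongr
      _ = _ := by
        have e1 : Real.exp (4 * k + 2 + 11 * M ^ 2 / (2 * K ^ 2)) ^ n =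
            Real.exp ((4 * k + 2) * n) * Real.exp (11 * M ^ 2 / (2 * K ^ 2) * n) := by
          rw [← Real.exp_nat_mul, ← Real.exp_add]; congr 1; ring
        rw [pow_succ D m]
        simp only [mul_pow, e1]
        field_simp
  · intro y hy μ
    have hr : 0 < K * κ / D := by positivity
    refine (hW.measureReal_sum_sq_le (block π a₀) y μ (K * κ / D) _ hr).trans ?_
    rw [hπ a₀]
    have e : 11 * M ^ 2 * n * (κ / D) ^ 2 / (2 * (K * κ / D) ^ 2) =
        11 * M ^ 2 / (2 * K ^ 2) * n := by field_simp
    rw [e]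
    gcongr
    · exact gaussAvg_nonneg _ _ _
    · have h1 := gaussAvg_le_of_farFromLattice (P₀.map ξ) hε hp hK hν (block π a₀) y hη hκ0 hr
        (D := D) (by rw [div_mul_cancel₀ _ hD0.ne']) hy.2.1
      have h2 : 1 / D ≤ κ / D := by gcongr
      have h3 : H * κ / D = 4 * (K * κ / D) / (√p * η * ε) + κ / D := by
        rw [hH]; field_simp
      rw [h3]
      linarith

/-! ### The alternative for a single unit vector -/

lemma exists_blocks {n k m : ℕ} (S : Finset (Fin n)) (h : k * m ≤ S.card) :
    ∃ π : Fin n → Option (Fin k), (∀ a, (block π a).card = m) ∧ ∀ i a, π i = some a → i ∈ S := by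
  classical
  obtain ⟨S', hS', hc⟩ := Finset.exists_subset_card_eq h
  have e : S' ≃ Fin k × Fin m := Fintype.equivOfCardEq (by simp [hc])
  set π : Fin n → Option (Fin k) := fun i => if h : i ∈ S' then some (e ⟨i, h⟩).1 else none with hπ
  have hiff : ∀ i a, π i = some a ↔ ∃ h : i ∈ S', (e ⟨i, h⟩).1 = a := by
    intro i a
    by_cases h : i ∈ S' <;> simp [hπ, h]
  refine ⟨π, fun a => ?_, fun i a hi => hS' ((hiff i a).1 hi).1⟩
  have hinj : Function.Injective fun b : Fin m => ((e.symm (a, b) : S') : Fin n) := fun b b' hb =>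
    (Prod.mk.inj (e.symm.injective (Subtype.ext hb))).2
  have : block π a = Finset.univ.image fun b : Fin m => ((e.symm (a, b) : S') : Fin n) := by
    ext i
    simp only [block, Finset.mem_filter, Finset.mem_univ, true_and, Finset.mem_image, hiff]
    constructor
    · rintro ⟨hi, rfl⟩
      exact ⟨(e ⟨i, hi⟩).2, by simp⟩
    · rintro ⟨b, rfl⟩
      exact ⟨(e.symm (a, b)).2, by simp⟩
  rw [this, Finset.card_image_of_injective _ hinj, Finset.card_univ, Fintype.card_fin]

lemma exists_mem_spreadVectors {n k m : ℕ} (hn : 0 < n) {ρ δ : ℝ} (hδ : 0 < δ)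
    (hkm : (k * m : ℕ) ≤ δ * n / 2) (v : Fin n → ℝ) (hv : ∑ i, v i ^ 2 = 1)
    (hsp : v ∉ sparseVectors n ρ δ) :
    ∃ π : Fin n → Option (Fin k), (∀ a, (block π a).card = m) ∧
      v ∈ spreadVectors (ρ / 2) √(2 / δ) π := by
  have hn' : (0 : ℝ) < n := by exact_mod_cast hn
  have hs : 0 < √(n : ℝ) := Real.sqrt_pos.2 hn'
  set A := Finset.univ.filter fun i => ρ / √(n : ℝ) / 2 ≤ |v i| with hA
  set B := Finset.univ.filter fun i => √(2 / δ) / √(n : ℝ) < |v i| with hB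
  have hAc : δ * n < A.card := by
    by_contra hc
    exact hsp ⟨hv, not_lt.1 hc⟩
  have hBc : (B.card : ℝ) ≤ δ * n / 2 := by
    have h1 : ∑ i ∈ B, (2 / δ / n) ≤ ∑ i ∈ B, v i ^ 2 := by
      refine Finset.sum_le_sum fun i hi => ?_
      have h2 := (Finset.mem_filter.1 hi).2
      rw [← sq_abs (v i)]
      calc 2 / δ / n = (√(2 / δ) / √(n : ℝ)) ^ 2 := by
            rw [div_pow, Real.sq_sqrt (by positivity), Real.sq_sqrt hn'.le]
        _ ≤ _ := by gcongr
    have h3 := h1.trans (sum_sq_le_one hv B)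
    rw [Finset.sum_const, nsmul_eq_mul, div_div, ← mul_div_assoc, div_le_one (by positivity)] at h3
    linarith
  have hS : k * m ≤ (A \ B).card := by
    have h1 := Finset.le_card_sdiff B A
    have h2 : (A.card : ℝ) - B.card ≤ (A \ B).card := by
      have : A.card ≤ (A \ B).card + B.card := by omega
      have : (A.card : ℝ) ≤ (A \ B).card + B.card := by exact_mod_cast this
      linarith
    have : ((k * m : ℕ) : ℝ) ≤ (A \ B).card := by linarith
    exact_mod_cast this
  obtain ⟨π, h1, h2⟩ := exists_blocks (A \ B) hS
  refine ⟨π, h1, hv, fun i a hi => ?_⟩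
  have := h2 i a hi
  simp only [hA, hB, Finset.mem_sdiff, Finset.mem_filter, Finset.mem_univ, true_and, not_lt] at this
  refine ⟨le_trans (le_of_eq (by ring)) this.1, this.2⟩

/-- Spread vectors have no lattice approximation by a dilate small enough to keep all coordinates
below `1 / 2`. -/
lemma mul_sq_le_latDistSq_of_spread {n k m : ℕ} (hn : 0 < n) {lo hi η : ℝ} (hlo : 0 < lo)
    (hhi : 1 ≤ hi) (hη : η ^ 2 ≤ m * lo ^ 2 / n) {π : Fin n → Option (Fin k)}
    (hπ : ∀ a, (block π a).card = m) {v : Fin n → ℝ} (hv : v ∈ spreadVectors lo hi π) (a : Fin k)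
    {θ : ℝ} (hθ0 : 0 < θ) (hθ : θ ≤ √(n : ℝ) / (2 * hi)) :
    (η * θ) ^ 2 ≤ latDistSq (block π a) (fun i => θ * v i) := by
  have hn' : (0 : ℝ) < n := by exact_mod_cast hn
  have hs : 0 < √(n : ℝ) := Real.sqrt_pos.2 hn'
  have hmem : ∀ i ∈ block π a, π i = some a := fun i hi => (Finset.mem_filter.1 hi).2
  refine le_trans ?_ (mul_sq_le_latDistSq (block π a) v θ fun i hmi => ?_)
  · have h1 : ∑ i ∈ block π a, lo ^ 2 / n ≤ ∑ i ∈ block π a, v i ^ 2 := by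
      refine Finset.sum_le_sum fun i hmi => ?_
      have h2 := (hv.2 i a (hmem i hmi)).1
      rw [← sq_abs (v i)]
      calc lo ^ 2 / n = (lo / √(n : ℝ)) ^ 2 := by rw [div_pow, Real.sq_sqrt hn'.le]
        _ ≤ _ := by gcongr
    rw [Finset.sum_const, hπ, nsmul_eq_mul, ← mul_div_assoc] at h1
    have := hη.trans h1
    rw [mul_pow, mul_comm]
    gcongr
  · have h2 := (hv.2 i a (hmem i hmi)).2
    rw [abs_mul, abs_of_pos hθ0]
    calc θ * |v i| ≤ √(n : ℝ) / (2 * hi) * (hi / √(n : ℝ)) := by gcongr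
      _ = 1 / 2 := by field_simp

lemma latDistSq_ceil_le {n : ℕ} {v : Fin n → ℝ} (hv : ∑ i, v i ^ 2 = 1) (I : Finset (Fin n))
    {θ κ : ℝ} (hθ : 0 ≤ θ) (hκ : 1 ≤ κ) (h : latDistSq I (fun i => θ * v i) ≤ κ ^ 2) :
    latDistSq I (fun i => (⌈θ⌉₊ : ℝ) * v i) ≤ 4 * κ ^ 2 := by
  have h1 : ((⌈θ⌉₊ : ℝ) - θ) ^ 2 ≤ 1 := by
    have a := Nat.le_ceil θ
    have b := Nat.ceil_lt_add_one hθ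
    nlinarith
  calc latDistSq I (fun i => (⌈θ⌉₊ : ℝ) * v i)
      ≤ ∑ i ∈ I, ((⌈θ⌉₊ : ℝ) * v i - round (θ * v i)) ^ 2 := by
        refine Finset.sum_le_sum fun i _ => sq_le_sq.2 ?_
        exact round_le _ _
    _ ≤ ∑ i ∈ I, (2 * (θ * v i - round (θ * v i)) ^ 2 + 2 * (((⌈θ⌉₊ : ℝ) - θ) ^ 2 * v i ^ 2)) := by
        refine Finset.sum_le_sum fun i _ => ?_
        nlinarith [sq_nonneg ((θ * v i - round (θ * v i)) - ((⌈θ⌉₊ : ℝ) - θ) * v i)]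
    _ = 2 * latDistSq I (fun i => θ * v i) + 2 * (((⌈θ⌉₊ : ℝ) - θ) ^ 2 * ∑ i ∈ I, v i ^ 2) := by
        rw [Finset.sum_add_distrib, ← Finset.mul_sum, ← Finset.mul_sum, ← Finset.mul_sum]; rfl
    _ ≤ 2 * κ ^ 2 + 2 * (1 * 1) := by
        have := sum_sq_le_one hv I
        have : 0 ≤ ∑ i ∈ I, v i ^ 2 := Finset.sum_nonneg fun _ _ => sq_nonneg _
        gcongr
    _ ≤ 4 * κ ^ 2 := by nlinarith

/-- A spread vector either has a block far from the lattice at level `D₁`, or belongs to a class of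
rational vectors at some intermediate level `D`: the last level at which some block is still far
from the lattice. -/
lemma farFromLattice_or_mem_rationalVectors {n k m : ℕ} (hn : 0 < n) (hk : 0 < k) {lo hi η κ : ℝ}
    (hlo : 0 < lo) (hhi : 1 ≤ hi) (hη0 : 0 < η) (hη : η ^ 2 ≤ m * lo ^ 2 / n) (hκ : 1 ≤ κ)
    {π : Fin n → Option (Fin k)} (hπ : ∀ a, (block π a).card = m) {v : Fin n → ℝ}
    (hv : v ∈ spreadVectors lo hi π) {D₀ D₁ : ℕ} (hD₀ : κ ≤ D₀)
    (hD₀n : (D₀ : ℝ) ≤ √(n : ℝ) / (2 * hi)) (hD : D₀ ≤ D₁) :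
    (∃ a, FarFromLattice (block π a) η κ D₁ v) ∨
      ∃ D : ℕ, D₀ ≤ D ∧ D < D₁ ∧ ∃ a₀, ∃ Θ : Fin k → ℕ,
        v ∈ rationalVectors lo hi η κ D π a₀ Θ := by
  have hκ0 : 0 < κ := by linarith
  by_contra hcon
  push Not at hcon
  obtain ⟨hfar, hrat⟩ := hcon
  have base : ∀ a, ∀ θ : ℝ, 0 < θ → θ ≤ √(n : ℝ) / (2 * hi) →
      min (η * θ) κ ^ 2 ≤ latDistSq (block π a) (fun i => θ * v i) := by
    intro a θ h0 h1
    refine le_trans ?_ (mul_sq_le_latDistSq_of_spread hn hlo hhi hη hπ hv a h0 h1)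
    have : 0 ≤ min (η * θ) κ := le_min (by positivity) hκ0.le
    gcongr
    exact min_le_left _ _
  have hind : ∀ D : ℕ, D₀ ≤ D → D ≤ D₁ → ∃ a, FarFromLattice (block π a) η κ D v := by
    intro D hD
    induction D, hD using Nat.le_induction with
    | base => exact fun _ => ⟨⟨0, hk⟩, fun θ h0 h1 => base _ θ h0 (h1.trans hD₀n)⟩
    | succ D hD ih =>
      intro hD1
      obtain ⟨a₀, ha₀⟩ := ih (by omega)
      by_contra hno
      push Not at hno
      unfold FarFromLattice at hno
      push Not at hno
      -- Every block now has an approximation by a dilate `θ a ≤ D + 1`; its denominator is `⌈θ a⌉`.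
      choose θ hθ0 hθ1 hθ2 using hno
      refine hrat D hD (by omega) a₀ (fun a => ⌈θ a⌉₊) ⟨hv, ha₀, fun a => ⟨?_, ?_, ?_⟩⟩
      · refine le_trans ?_ (Nat.le_ceil _)
        by_contra hc
        exact absurd (base a (θ a) (hθ0 a) (not_le.1 hc).le) (not_le.2 (hθ2 a))
      · have h1 : ⌈θ a⌉₊ ≤ D + 1 := Nat.ceil_le.2 (hθ1 a)
        have h2 : 1 ≤ D := by
          have : (1 : ℝ) ≤ D₀ := hκ.trans hD₀
          have : 1 ≤ D₀ := by exact_mod_cast this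
          omega
        have : ⌈θ a⌉₊ ≤ 2 * D := by omega
        exact_mod_cast this
      · refine latDistSq_ceil_le hv.1 _ (hθ0 a).le hκ ((hθ2 a).le.trans ?_)
        have : 0 ≤ min (η * θ a) κ := le_min (by have := hθ0 a; positivity) hκ0.le
        gcongr
        exact min_le_right _ _
  obtain ⟨a, ha⟩ := hind D₁ hD le_rfl
  exact hfar a ha

/-! ### Asymptotic estimates -/

lemma eventually_mul_log_ge (B₀ B₁ B₂ : ℝ) {s : ℝ} (hs : 0 < s) :
    ∀ᶠ n : ℕ in atTop, B₀ + B₁ * Real.log n + B₂ * n ≤ s * (n * Real.log n) := by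
  have h1 : ∀ᶠ n : ℕ in atTop, (|B₀| + |B₁| + |B₂|) / s ≤ Real.log n :=
    (Real.tendsto_log_atTop.comp tendsto_natCast_atTop_atTop).eventually_ge_atTop _
  filter_upwards [h1, eventually_ge_atTop 1] with n hn hn1
  have hn1' : (1 : ℝ) ≤ n := by exact_mod_cast hn1
  have hl0 : 0 ≤ Real.log n := Real.log_nonneg hn1'
  have hl : Real.log n ≤ n := (Real.log_le_sub_one_of_pos (by linarith)).trans (by linarith)
  rw [div_le_iff₀ hs] at hn
  have a0 : B₀ ≤ |B₀| * n := (le_abs_self _).trans (le_mul_of_one_le_right (abs_nonneg _) hn1')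
  have a1 : B₁ * Real.log n ≤ |B₁| * n :=
    mul_le_mul (le_abs_self _) hl hl0 (abs_nonneg _)
  have a2 : B₂ * n ≤ |B₂| * n := by gcongr; exact le_abs_self _
  have := mul_le_mul_of_nonneg_right hn (by linarith : (0 : ℝ) ≤ n)
  nlinarith

lemma eventually_exp_neg_rpow_le {c e : ℝ} (hc : 0 < c) (he : 0 < e) (B : ℝ) {τ : ℝ} (hτ : 0 < τ) :
    ∀ᶠ n : ℕ in atTop, Real.exp (-c * ((n : ℝ) ^ e) ^ 2) ≤ τ * (n : ℝ) ^ (-B) := by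
  have h1 := isLittleO_exp_neg_mul_rpow_atTop hc (-B / (2 * e))
  have h2 : Tendsto (fun n : ℕ => (n : ℝ) ^ (2 * e)) atTop atTop :=
    (tendsto_rpow_atTop (by positivity)).comp tendsto_natCast_atTop_atTop
  have h3 := (h1.comp_tendsto h2).def hτ
  filter_upwards [h3, eventually_ge_atTop 1] with n hn hn1
  have hn0 : (0 : ℝ) ≤ n := Nat.cast_nonneg n
  simp only [Function.comp_apply, Real.norm_eq_abs, Real.abs_exp] at hn
  rw [abs_of_nonneg (by positivity), ← Real.rpow_mul hn0,
    show 2 * e * (-B / (2 * e)) = -B by field_simp] at hn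
  have e1 : ((n : ℝ) ^ e) ^ 2 = (n : ℝ) ^ (2 * e) := by
    rw [← Real.rpow_natCast, ← Real.rpow_mul hn0]; congr 1; push_cast; ring
  rw [e1]; exact hn

lemma eventually_exp_neg_mul_le {c : ℝ} (hc : 0 < c) (B : ℝ) {τ : ℝ} (hτ : 0 < τ) :
    ∀ᶠ n : ℕ in atTop, Real.exp (-c * n) ≤ τ * (n : ℝ) ^ (-B) := by
  have h := eventually_exp_neg_rpow_le hc (e := 1 / 2) (by norm_num) B hτ
  filter_upwards [h] with n hn
  rwa [← Real.sqrt_eq_rpow, Real.sq_sqrt (Nat.cast_nonneg n)] at hn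

lemma eventually_rpow_le_sqrt {e : ℝ} (he : e < 1 / 2) {τ : ℝ} (hτ : 0 < τ) :
    ∀ᶠ n : ℕ in atTop, (n : ℝ) ^ e + 1 ≤ τ * √(n : ℝ) := by
  have h2 : ∀ᶠ n : ℕ in atTop, (n : ℝ) ^ (-(1 / 2 - e)) ≤ τ / 2 :=
    ((tendsto_rpow_neg_atTop (by linarith : 0 < 1 / 2 - e)).comp
      tendsto_natCast_atTop_atTop).eventually_le_const (half_pos hτ)
  have h3 : ∀ᶠ n : ℕ in atTop, 2 / τ ≤ √(n : ℝ) :=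
    (Real.tendsto_sqrt_atTop.comp tendsto_natCast_atTop_atTop).eventually_ge_atTop _
  filter_upwards [h2, h3, eventually_ge_atTop 1] with n hn hn2 hn1
  have hn0 : (0 : ℝ) < n := by exact_mod_cast hn1
  rw [div_le_iff₀ hτ] at hn2
  have e1 : (n : ℝ) ^ e = (n : ℝ) ^ (-(1 / 2 - e)) * √(n : ℝ) := by
    rw [Real.sqrt_eq_rpow, ← Real.rpow_add hn0]; congr 1; ring
  have := mul_le_mul_of_nonneg_right hn (Real.sqrt_nonneg (n : ℝ))
  linarith

/-- The bound of the union over all classes of rational vectors: the gain `√n ^ (k * m)`, which is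
about `n ^ (δ * n / 4)`, dominates every other factor. -/
lemma eventually_count_le {k A : ℕ} (hk : 0 < k) (hkA : 8 * A ≤ k) {δ M Q : ℝ} (hδ : 0 < δ)
    (hM : 1 ≤ M) (hQ : 0 < Q) (α : ℝ) :
    ∀ᶠ n : ℕ in atTop, ∀ m : ℕ, m = ⌊δ * n / (2 * k)⌋₊ →
      ((k + 1 : ℝ) ^ n * (n ^ A * (k * (2 * n ^ A + 1) ^ k))) *
        (4 * M * Q ^ n * ((n : ℝ) ^ (δ / 16)) ^ n * ((n : ℝ) ^ A) ^ (m + 1) / √(n : ℝ) ^ (k * m)) ≤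
      1 / 2 * (n : ℝ) ^ (-α) := by
  have h := eventually_mul_log_ge (Real.log k + k * Real.log 3 + Real.log (4 * M) + Real.log 2)
    (A + k * A + A + k / 2 + α) (Real.log (k + 1) + Real.log Q) (s := δ / 8) (by positivity)
  filter_upwards [h, eventually_ge_atTop 1] with n hn hn1 m hm
  have hn1' : (1 : ℝ) ≤ n := by exact_mod_cast hn1
  have hn0 : (0 : ℝ) < n := by linarith
  have hk0 : (0 : ℝ) < k := by exact_mod_cast hk
  have hkA' : 8 * (A : ℝ) ≤ k := by exact_mod_cast hkA
  set l := Real.log n with hl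
  have hl0 : 0 ≤ l := Real.log_nonneg hn1'
  have hnl : (n : ℝ) = Real.exp l := (Real.exp_log hn0).symm
  have hm1 : (m : ℝ) ≤ δ * n / (2 * k) := by rw [hm]; exact Nat.floor_le (by positivity)
  have hm2 : δ * n / (2 * k) - 1 ≤ m := by
    rw [hm]; linarith [Nat.lt_floor_add_one (δ * n / (2 * k))]
  have f1 : (k + 1 : ℝ) ^ n = Real.exp (n * Real.log (k + 1)) := by
    rw [Real.exp_nat_mul, Real.exp_log (by positivity)]
  have f2 : (n : ℝ) ^ A = Real.exp (A * l) := by rw [Real.exp_nat_mul, ← hnl]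
  have f3 : (k : ℝ) = Real.exp (Real.log k) := (Real.exp_log hk0).symm
  have f4 : (2 * (n : ℝ) ^ A + 1) ^ k ≤ Real.exp (k * (Real.log 3 + A * l)) := by
    rw [Real.exp_nat_mul, Real.exp_add, Real.exp_log (by norm_num), ← f2]
    gcongr
    have : (1 : ℝ) ≤ (n : ℝ) ^ A := one_le_pow₀ hn1'
    linarith
  have f5 : 4 * M = Real.exp (Real.log (4 * M)) := (Real.exp_log (by positivity)).symm
  have f6 : Q ^ n = Real.exp (n * Real.log Q) := by
    rw [Real.exp_nat_mul, Real.exp_log hQ]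
  have f7 : ((n : ℝ) ^ (δ / 16)) ^ n = Real.exp (n * (l * (δ / 16))) := by
    rw [Real.exp_nat_mul, Real.rpow_def_of_pos hn0]
  have f8 : ((n : ℝ) ^ A) ^ (m + 1) = Real.exp (((m + 1 : ℕ) : ℝ) * (A * l)) := by
    rw [Real.exp_nat_mul, ← f2]
  have f9 : √(n : ℝ) ^ (k * m) = Real.exp (((k * m : ℕ) : ℝ) * (l * (1 / 2))) := by
    rw [Real.exp_nat_mul, Real.sqrt_eq_rpow, Real.rpow_def_of_pos hn0]
  have f10 : 1 / 2 * (n : ℝ) ^ (-α) = Real.exp (-Real.log 2 + l * (-α)) := by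
    rw [Real.exp_add, Real.exp_neg, Real.exp_log (by norm_num), Real.rpow_def_of_pos hn0, one_div]
  calc _ ≤ (Real.exp (n * Real.log (k + 1)) * (Real.exp (A * l) * (Real.exp (Real.log k) *
          Real.exp (k * (Real.log 3 + A * l))))) *
        (Real.exp (Real.log (4 * M)) * Real.exp (n * Real.log Q) *
          Real.exp (n * (l * (δ / 16))) * Real.exp (((m + 1 : ℕ) : ℝ) * (A * l)) /
          Real.exp (((k * m : ℕ) : ℝ) * (l * (1 / 2)))) := by
        rw [← f1, ← f2, ← f3, ← f5, ← f6, ← f7, ← f8, ← f9]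
        gcongr
    _ = Real.exp (n * Real.log (k + 1) + (A * l + (Real.log k + k * (Real.log 3 + A * l))) +
        (Real.log (4 * M) + n * Real.log Q + n * (l * (δ / 16)) + ((m + 1 : ℕ) : ℝ) * (A * l) -
          ((k * m : ℕ) : ℝ) * (l * (1 / 2)))) := by
        simp only [Real.exp_add, Real.exp_sub]
    _ ≤ _ := by
        rw [f10, Real.exp_le_exp]
        push_cast
        have g1 : (A : ℝ) * m ≤ δ * n / 16 := by
          calc (A : ℝ) * m ≤ k / 8 * (δ * n / (2 * k)) := by gcongr; linarith
            _ = _ := by field_simp; ring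
        have g2 : δ * n / 2 - k ≤ k * m := by
          have := mul_le_mul_of_nonneg_left hm2 hk0.le
          rw [mul_sub, mul_one, show (k : ℝ) * (δ * n / (2 * k)) = δ * n / 2 by field_simp] at this
          exact this
        have g3 := mul_le_mul_of_nonneg_right g1 hl0
        have g4 := mul_le_mul_of_nonneg_right g2 hl0
        nlinarith

/-! ### Eigenvectors have a block far from the lattice -/

set_option maxHeartbeats 1000000 in
/-- With probability at least `1 - n ^ (-α)` on the event `‖W‖ ≤ M √n`, every unit eigenvector has a
set of coordinates on which it is far from the lattice up to level `n ^ A`. -/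
theorem exists_measureReal_structured_eigenvector_le {ε p K M α : ℝ} (hε : 0 < ε) (hp : 0 < p)
    (hK : 0 < K) (hM : 1 ≤ M) {A : ℕ} (hA : 1 ≤ A) :
    ∃ (η e : ℝ) (N : ℕ), 0 < η ∧ 0 < e ∧ e < 1 / 2 ∧
      ∀ {Ω Ω₀ : Type*} [MeasurableSpace Ω] [MeasurableSpace Ω₀] (P : Measure Ω)
        [IsProbabilityMeasure P] (P₀ : Measure Ω₀) (n : ℕ) (W : Ω → Matrix (Fin n) (Fin n) ℝ)
        (ξ ζ : Ω₀ → ℝ) [IsProbabilityMeasure (P₀.map ξ)], HasSpread (P₀.map ξ) ε p K →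
        IsWigner P P₀ W ξ ζ → N ≤ n →
        P.real {ω | (∀ x : Fin n → ℝ, ∑ j, (W ω).mulVec x j ^ 2 ≤ M ^ 2 * n * ∑ i, x i ^ 2) ∧
          ∃ v : Fin n → ℝ, (∑ i, v i ^ 2 = 1 ∧
            ∀ I, ¬ FarFromLattice I η ((n : ℝ) ^ e) ((n ^ A : ℕ) : ℝ) v) ∧
            ∃ lam : ℝ, ∀ j, (W ω).mulVec v j = lam * v j} ≤ (n : ℝ) ^ (-α) := by
  obtain ⟨ρ, δ, c, C, hρ0, hρ1, hδ0, hδ1, hc, hC, hsparse⟩ :=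
    exists_measureReal_sparse_eigenvector_le hε hp hK hM
  set k : ℕ := 8 * A with hkdef
  have hk : 0 < k := by omega
  have hk0 : (0 : ℝ) < k := by exact_mod_cast hk
  set lo : ℝ := ρ / 2 with hlo
  set hi : ℝ := √(2 / δ) with hhi
  have hhi1 : 1 ≤ hi := by
    rw [hhi, Real.one_le_sqrt, le_div_iff₀ hδ0]; linarith
  have hlo0 : 0 < lo := by positivity
  set η : ℝ := lo * √(δ / (4 * k)) with hη
  have hη0 : 0 < η := by positivity
  set e : ℝ := δ / 16 with he
  have he0 : 0 < e := by positivity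
  have he1 : e < 1 / 2 := by rw [he]; linarith
  have hsp : 0 < √p := Real.sqrt_pos.2 hp
  set Q : ℝ := Real.exp (4 * k + 2 + 11 * M ^ 2 / (2 * K ^ 2)) * (24 * hi) *
        (4 * K / (√p * η * ε) + 1) with hQ
  have hQ0 : 0 < Q := by positivity
  -- `E1`: union bound over rational vectors; `E2`: sparse vectors; `E3`, `E4`: tails in the small-ball
  -- bound; `E5`: the first level `⌈κ⌉` is below the trivial range; `E6`: the blocks have size of order `n`.
  have E1 := eventually_count_le hk le_rfl hδ0 hM hQ0 α
  have E2 := eventually_exp_neg_mul_le hc α (τ := 1 / (2 * C)) (by positivity)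
  have E3 := eventually_exp_neg_rpow_le (c := 2 * p) (by positivity) he0 A (τ := 1 / 2) (by norm_num)
  have E4 := eventually_exp_neg_rpow_le (c := 1 / 4) (by positivity) he0 A (τ := 1 / 4) (by norm_num)
  have E5 := eventually_rpow_le_sqrt he1 (τ := 1 / (2 * hi)) (by positivity)
  have E6 := (tendsto_natCast_atTop_atTop (R := ℝ)).eventually_ge_atTop (4 * k / δ)
  obtain ⟨N, hN⟩ := eventually_atTop.1
    ((((((E1.and E2).and E3).and E4).and E5).and E6).and (eventually_ge_atTop 2))
  refine ⟨η, e, N, hη0, he0, he1, ?_⟩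
  intro Ω Ω₀ _ _ P _ P₀ n W ξ ζ _ hν hW hNn
  obtain ⟨⟨⟨⟨⟨⟨hcount, hexp⟩, ht1⟩, ht2⟩, hsqrt⟩, hlarge⟩, hn2⟩ := hN n hNn
  have hn0 : 0 < n := by omega
  have hn1' : (1 : ℝ) ≤ n := by exact_mod_cast hn0
  have hn' : (0 : ℝ) < n := by linarith
  set κ : ℝ := (n : ℝ) ^ e with hκ
  have hκ1 : 1 ≤ κ := Real.one_le_rpow hn1' he0.le
  have hκ0 : 0 < κ := by linarith
  set m : ℕ := ⌊δ * n / (2 * k)⌋₊ with hm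
  have hm1 : (m : ℝ) ≤ δ * n / (2 * k) := Nat.floor_le (by positivity)
  have hm2 : δ * n / (4 * k) ≤ m := by
    have h1 := Nat.lt_floor_add_one (δ * n / (2 * k))
    rw [div_le_iff₀ hδ0] at hlarge
    have h2 : 1 ≤ δ * n / (4 * k) := by rw [le_div_iff₀ (by positivity)]; linarith
    have h3 : δ * n / (2 * k) = 2 * (δ * n / (4 * k)) := by field_simp; norm_num
    rw [h3] at h1
    rw [← h3, ← hm] at h1
    linarith
  have hmn : m ≤ n := by
    have : (m : ℝ) ≤ n := by
      refine hm1.trans ?_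
      rw [div_le_iff₀ (by positivity)]
      have : (1 : ℝ) ≤ k := by exact_mod_cast hk
      nlinarith
    exact_mod_cast this
  have hkm : ((k * m : ℕ) : ℝ) ≤ δ * n / 2 := by
    push_cast
    calc (k : ℝ) * m ≤ k * (δ * n / (2 * k)) := by gcongr
      _ = _ := by field_simp
  have hη2 : η ^ 2 ≤ m * lo ^ 2 / n := by
    rw [hη, mul_pow, Real.sq_sqrt (by positivity), le_div_iff₀ hn']
    calc lo ^ 2 * (δ / (4 * k)) * n = δ * n / (4 * k) * lo ^ 2 := by ring
      _ ≤ _ := by gcongr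
  have hD₀ : (⌈κ⌉₊ : ℝ) ≤ √(n : ℝ) / (2 * hi) := by
    have := Nat.ceil_lt_add_one hκ0.le
    have e1 : 1 / (2 * hi) * √(n : ℝ) = √(n : ℝ) / (2 * hi) := by ring
    linarith
  have hD₁ : ⌈κ⌉₊ ≤ n ^ A := by
    have h1 : √(n : ℝ) / (2 * hi) ≤ n := by
      rw [div_le_iff₀ (by positivity)]
      have : √(n : ℝ) ≤ n := by
        rw [Real.sqrt_le_left (by positivity)]; nlinarith
      nlinarith
    have h2 : ⌈κ⌉₊ ≤ n := by exact_mod_cast hD₀.trans h1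
    exact h2.trans (Nat.le_self_pow (by omega) n)
  set ev : Set (Fin n → ℝ) → Set Ω := fun T =>
    {ω | (∀ x : Fin n → ℝ, ∑ j, (W ω).mulVec x j ^ 2 ≤ M ^ 2 * n * ∑ i, x i ^ 2) ∧
      ∃ v ∈ T, ∃ lam : ℝ, ∀ j, (W ω).mulVec v j = lam * v j} with hev
  set idx : Finset ((Fin n → Option (Fin k)) × Fin (n ^ A) × Fin k × (Fin k → Fin (2 * n ^ A + 1))) :=
    Finset.univ.filter fun x => (∀ a, (block x.1 a).card = m) ∧ κ ≤ ((x.2.1 : ℕ) : ℝ) with hidx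
  set T : ((Fin n → Option (Fin k)) × Fin (n ^ A) × Fin k × (Fin k → Fin (2 * n ^ A + 1))) →
      Set (Fin n → ℝ) := fun x =>
    rationalVectors lo hi η κ ((x.2.1 : ℕ) : ℝ) x.1 x.2.2.1 (fun a => (x.2.2.2 a : ℕ)) with hT
  have hcover : ev {v | ∑ i, v i ^ 2 = 1 ∧ ∀ I, ¬ FarFromLattice I η κ ((n ^ A : ℕ) : ℝ) v} ⊆
      ev (sparseVectors n ρ δ) ∪ ⋃ x ∈ idx, ev (T x) := by
    rintro ω ⟨hnorm, v, ⟨hv1, hvfar⟩, hlam⟩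
    by_cases hvs : v ∈ sparseVectors n ρ δ
    · exact Or.inl ⟨hnorm, v, hvs, hlam⟩
    · right
      obtain ⟨π, hπ, hvπ⟩ := exists_mem_spreadVectors hn0 hδ0 hkm v hv1 hvs
      rcases farFromLattice_or_mem_rationalVectors hn0 hk hlo0 hhi1 hη0 hη2 hκ1 hπ hvπ
        (Nat.le_ceil κ) hD₀ hD₁ with ⟨a, ha⟩ | ⟨D, hD1, hD2, a₀, Θ, hΘ⟩
      · exact absurd ha (hvfar _)
      · have hΘlt : ∀ a, Θ a < 2 * n ^ A + 1 := by
          intro a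
          have h1 : Θ a ≤ 2 * D := by exact_mod_cast (hΘ.2.2 a).2.1
          omega
        simp only [Set.mem_iUnion]
        refine ⟨(π, ⟨D, hD2⟩, a₀, fun a => ⟨Θ a, hΘlt a⟩), ?_, hnorm, v, hΘ, hlam⟩
        rw [hidx, Finset.mem_filter]
        refine ⟨Finset.mem_univ _, hπ, ?_⟩
        exact (Nat.le_ceil κ).trans (by exact_mod_cast hD1)
  set β : ℝ := 4 * M * Q ^ n * κ ^ n * ((n : ℝ) ^ A) ^ (m + 1) / √(n : ℝ) ^ (k * m) with hβ
  have hbound : ∀ x ∈ idx, P.real (ev (T x)) ≤ β := by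
    rintro ⟨π, D, a₀, Θ⟩ hx
    obtain ⟨-, hπ, hκD⟩ := Finset.mem_filter.1 hx
    simp only at hπ hκD
    have hDA : ((D : ℕ) : ℝ) ≤ (n : ℝ) ^ A := by exact_mod_cast D.2.le
    have hD0 : (0 : ℝ) < ((D : ℕ) : ℝ) := by linarith
    refine (hW.measureReal_rational_eigenvector_le hε hp hK hM hν hn0 hmn hhi1 hη0 hκ1 hκD
      ?_ π hπ a₀ (fun a => (Θ a : ℕ))).trans ?_
    · have h1 : (n : ℝ) ^ (-(A : ℝ)) ≤ 1 / ((D : ℕ) : ℝ) := by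
        rw [Real.rpow_neg hn'.le, Real.rpow_natCast, ← one_div]
        gcongr
      rw [show -2 * p = -(2 * p) by ring, show -κ ^ 2 / 4 = -(1 / 4) * κ ^ 2 by ring]
      linarith
    · rw [hβ, hQ]
      gcongr
  have hcard : (idx.card : ℝ) ≤ (k + 1 : ℝ) ^ n * ((n : ℝ) ^ A * (k * (2 * (n : ℝ) ^ A + 1) ^ k)) := by
    have h1 := Finset.card_le_univ idx
    simp only [Fintype.card_prod, Fintype.card_pi, Fintype.card_option, Fintype.card_fin,
      Finset.prod_const, Finset.card_univ] at h1
    exact_mod_cast h1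
  have h1 : P.real (ev (sparseVectors n ρ δ)) ≤ 1 / 2 * (n : ℝ) ^ (-α) := by
    refine (hsparse P P₀ n W ξ ζ hν hW hn2).trans ?_
    calc C * Real.exp (-c * n) ≤ C * (1 / (2 * C) * (n : ℝ) ^ (-α)) := by gcongr
      _ = _ := by field_simp
  have hβ0 : 0 ≤ β := by positivity
  have h2 : P.real (⋃ x ∈ idx, ev (T x)) ≤ 1 / 2 * (n : ℝ) ^ (-α) := by
    calc P.real (⋃ x ∈ idx, ev (T x)) ≤ ∑ x ∈ idx, P.real (ev (T x)) :=
          measureReal_biUnion_finset_le _ _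
      _ ≤ ∑ x ∈ idx, β := Finset.sum_le_sum hbound
      _ = idx.card * β := by simp
      _ ≤ _ := by gcongr
      _ ≤ _ := hcount m rfl
  calc _ = P.real (ev {v | ∑ i, v i ^ 2 = 1 ∧
        ∀ I, ¬ FarFromLattice I η κ ((n ^ A : ℕ) : ℝ) v}) := rfl
    _ ≤ P.real (ev (sparseVectors n ρ δ) ∪ ⋃ x ∈ idx, ev (T x)) :=
        measureReal_mono hcover (measure_ne_top _ _)
    _ ≤ _ := measureReal_union_le _ _
    _ ≤ _ := by linarith

/-! ### Transfer to the random vector `b` -/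

lemma sum_sq_mulVec_le_of_norm_le {n : ℕ} {B : Matrix (Fin n) (Fin n) ℝ} {M : ℝ}
    (h : ‖Matrix.toEuclideanCLM (n := Fin n) (𝕜 := ℝ) B‖ ≤ M * √(n : ℝ)) (x : Fin n → ℝ) :
    ∑ j, B.mulVec x j ^ 2 ≤ M ^ 2 * n * ∑ i, x i ^ 2 := by
  have h1 := (Matrix.toEuclideanCLM (n := Fin n) (𝕜 := ℝ) B).le_of_opNorm_le h (WithLp.toLp 2 x)
  have h2 := pow_le_pow_left₀ (norm_nonneg _) h1 2
  rw [Matrix.toEuclideanCLM_toLp, mul_pow, EuclideanSpace.norm_sq_eq, EuclideanSpace.norm_sq_eq,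
    mul_pow, Real.sq_sqrt (Nat.cast_nonneg n)] at h2
  simpa using h2

/-- If `v` and `b` are independent and `v` avoids the vectors `y` for which `⟪y, b⟫ = 0` has
probability above `q`, then `⟪v, b⟫ = 0` has probability at most `q`. -/
lemma measureReal_inner_eq_zero_le_of_indepFun {Ω : Type*} [MeasurableSpace Ω] {P : Measure Ω}
    [IsProbabilityMeasure P] {n : ℕ} {v b : Ω → EuclideanSpace ℝ (Fin n)} (hv : Measurable v)
    (hb : Measurable b) (hvb : IndepFun v b P) {q : ℝ} (hq : 0 ≤ q) :
    P.real {ω | P.real {ω' | inner ℝ (v ω) (b ω') = 0} ≤ q ∧ inner ℝ (v ω) (b ω) = 0} ≤ q := by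
  set Z : Set (EuclideanSpace ℝ (Fin n) × EuclideanSpace ℝ (Fin n)) :=
    {z | inner ℝ z.1 z.2 = 0} with hZ
  have hZm : MeasurableSet Z := by
    have : Measurable fun z : EuclideanSpace ℝ (Fin n) × EuclideanSpace ℝ (Fin n) =>
      inner ℝ z.1 z.2 := by fun_prop
    exact this (measurableSet_singleton 0)
  have hbp : IsProbabilityMeasure (P.map b) := Measure.isProbabilityMeasure_map hb.aemeasurable
  have hvp : IsProbabilityMeasure (P.map v) := Measure.isProbabilityMeasure_map hv.aemeasurable
  have hgm : Measurable fun y => (P.map b) (Prod.mk y ⁻¹' Z) := measurable_measure_prodMk_left hZm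
  set U : Set (EuclideanSpace ℝ (Fin n) × EuclideanSpace ℝ (Fin n)) :=
    {z | (P.map b) (Prod.mk z.1 ⁻¹' Z) ≤ ENNReal.ofReal q} ∩ Z with hU
  have hUm : MeasurableSet U :=
    (measurableSet_le (hgm.comp measurable_fst) measurable_const).inter hZm
  have hgy : ∀ y, (P.map b) (Prod.mk y ⁻¹' Z) = P {ω' | inner ℝ y (b ω') = 0} := by
    intro y
    rw [Measure.map_apply hb (measurable_prodMk_left hZm)]; rfl
  have hset : {ω | P.real {ω' | inner ℝ (v ω) (b ω') = 0} ≤ q ∧ inner ℝ (v ω) (b ω) = 0} =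
      (fun ω => (v ω, b ω)) ⁻¹' U := by
    ext ω
    simp only [hU, hZ, Set.mem_preimage, Set.mem_inter_iff, Set.mem_ofPred_eq]
    rw [← hZ, hgy, ENNReal.le_ofReal_iff_toReal_le (measure_ne_top _ _) hq]
    rfl
  rw [hset, measureReal_def, ← Measure.map_apply (hv.prodMk hb) hUm,
    (indepFun_iff_map_prod_eq_prod_map_map hv.aemeasurable hb.aemeasurable).1 hvb,
    Measure.prod_apply hUm]
  refine ENNReal.toReal_le_of_le_ofReal hq ?_
  calc ∫⁻ y, (P.map b) (Prod.mk y ⁻¹' U) ∂(P.map v) ≤ ∫⁻ _, ENNReal.ofReal q ∂(P.map v) := by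
        refine lintegral_mono fun y => ?_
        by_cases hy : (P.map b) (Prod.mk y ⁻¹' Z) ≤ ENNReal.ofReal q
        · exact (measure_mono fun z hz => hz.2).trans hy
        · have : Prod.mk y ⁻¹' U = ∅ := Set.eq_empty_of_forall_notMem fun z hz => hy hz.1
          rw [this]; simp
    _ = _ := by simp

/-- A vector far from the lattice up to level `n ^ A` is orthogonal to `b` with probability at most
`n ^ (-α)`. -/
lemma exists_gaussAvg_le_rpow {ε p K α η e : ℝ} (hε : 0 < ε) (hp : 0 < p) (hK : 0 < K)
    (hη : 0 < η) (he : 0 < e) (he1 : e < 1 / 2) {A : ℕ} (hA : α + 2 ≤ A) :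
    ∃ N : ℕ, ∀ n : ℕ, N ≤ n → ∃ r : ℝ, ∀ (ν : Measure ℝ) [IsProbabilityMeasure ν],
      HasSpread ν ε p K → ∀ (I : Finset (Fin n)) (y : Fin n → ℝ),
      FarFromLattice I η ((n : ℝ) ^ e) ((n ^ A : ℕ) : ℝ) y →
      gaussAvg ν I (fun i => y i / r) ≤ (n : ℝ) ^ (-α) := by
  have hsp : 0 < √p := Real.sqrt_pos.2 hp
  set H : ℝ := 4 * K / (√p * η * ε) with hH
  have hH0 : 0 < H := by positivity
  have E1 := eventually_exp_neg_rpow_le (c := 2 * p) (by positivity) he α (τ := 1 / 4) (by norm_num)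
  have E2 := eventually_exp_neg_rpow_le (c := 1 / 4) (by positivity) he α (τ := 1 / 8) (by norm_num)
  have E3 := (tendsto_natCast_atTop_atTop (R := ℝ)).eventually_ge_atTop (2 * H)
  obtain ⟨N, hN⟩ := eventually_atTop.1 (((E1.and E2).and E3).and (eventually_ge_atTop 1))
  refine ⟨N, fun n hn => ?_⟩
  obtain ⟨⟨⟨h1, h2⟩, h3⟩, hn1⟩ := hN n hn
  have hn1' : (1 : ℝ) ≤ n := by exact_mod_cast hn1
  have hn0 : (0 : ℝ) < n := by linarith
  set κ : ℝ := (n : ℝ) ^ e with hκ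
  have hκ0 : 0 < κ := by positivity
  have hD0 : (0 : ℝ) < ((n ^ A : ℕ) : ℝ) := by positivity
  refine ⟨K * κ / ((n ^ A : ℕ) : ℝ), fun ν _ hν I y hy => ?_⟩
  refine (gaussAvg_le_of_farFromLattice ν hε hp hK hν I y hη hκ0 (by positivity)
    (by rw [div_mul_cancel₀ _ hD0.ne']) hy).trans ?_
  have hκn : κ ≤ (n : ℝ) ^ (1 : ℝ) := Real.rpow_le_rpow_of_exponent_le hn1' (by linarith)
  have h4 : 4 * (K * κ / ((n ^ A : ℕ) : ℝ)) / (√p * η * ε) ≤ 1 / 2 * (n : ℝ) ^ (-α) := by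
    have e1 : 4 * (K * κ / ((n ^ A : ℕ) : ℝ)) / (√p * η * ε) = H * (κ / (n : ℝ) ^ (A : ℝ)) := by
      rw [hH, Real.rpow_natCast]; push_cast; field_simp
    have e2 : κ / (n : ℝ) ^ (A : ℝ) ≤ (n : ℝ) ^ (-α) * (n : ℝ)⁻¹ := by
      calc κ / (n : ℝ) ^ (A : ℝ) ≤ (n : ℝ) ^ (1 : ℝ) / (n : ℝ) ^ (A : ℝ) := by gcongr
        _ = (n : ℝ) ^ (1 - (A : ℝ)) := by rw [Real.rpow_sub hn0]
        _ ≤ (n : ℝ) ^ (-α + -1) := Real.rpow_le_rpow_of_exponent_le hn1' (by linarith)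
        _ = _ := by rw [Real.rpow_add hn0, Real.rpow_neg_one]
    rw [e1]
    calc H * (κ / (n : ℝ) ^ (A : ℝ)) ≤ H * ((n : ℝ) ^ (-α) * (n : ℝ)⁻¹) := by gcongr
      _ = H / n * (n : ℝ) ^ (-α) := by ring
      _ ≤ _ := by
        have h5 : H / n ≤ 1 / 2 := by rw [div_le_iff₀ hn0]; linarith
        gcongr
  rw [show -2 * p = -(2 * p) by ring, show -κ ^ 2 / 4 = -(1 / 4) * κ ^ 2 by ring]
  linarith

theorem theorem5p4
    (ε₀ p₀ K₀ ε₁ p₁ K₁ M α : ℝ)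
    (hε₀ : 0 < ε₀) (hp₀ : 0 < p₀) (hK₀ : 0 < K₀)
    (hε₁ : 0 < ε₁) (hp₁ : 0 < p₁) (hK₁ : 0 < K₁)
    (hM : 1 ≤ M) (hα : 0 < α) :
    ∃ C : ℝ, 0 < C ∧
      ∀ {Ω₀ : Type*} [MeasurableSpace Ω₀] (P₀ : Measure Ω₀) [IsProbabilityMeasure P₀]
        (ξ ζ ψ : Ω₀ → ℝ), Measurable ξ → Measurable ζ → Measurable ψ →
        IsNondegenerateWith P₀ ξ ε₀ p₀ K₀ →
        IsNondegenerateWith P₀ ψ ε₁ p₁ K₁ →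
      ∀ {Ω : Type*} [MeasurableSpace Ω] (P : Measure Ω) [IsProbabilityMeasure P]
        (n : ℕ) (W : Ω → Matrix (Fin n) (Fin n) ℝ) (b : Ω → EuclideanSpace ℝ (Fin n)),
        IsWigner P P₀ W ξ ζ →
        1 / 2 ≤ P.real (normEvent W M) →
        IsIIDVector P P₀ b ψ →
        IndepFun (fun ω i j => W ω i j) b P →
      ∀ v : Ω → EuclideanSpace ℝ (Fin n), Measurable v →
        IsUnitEigenvector P W v →
        IndepFun v b P →
        (P[|normEvent W M]).real {ω | inner ℝ (v ω) (b ω) = 0} ≤ C * (n : ℝ) ^ (-α) := by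
  obtain ⟨A, hA⟩ := exists_nat_ge (α + 2)
  have hA1 : 1 ≤ A := by
    have : (1 : ℝ) ≤ A := by linarith
    exact_mod_cast this
  obtain ⟨η, e, N₁, hη, he, he1, hstruct⟩ :=
    exists_measureReal_structured_eigenvector_le (α := α) hε₀ hp₀ hK₀ hM hA1
  obtain ⟨N₂, hsmall⟩ := exists_gaussAvg_le_rpow hε₁ hp₁ hK₁ hη he he1 hA
  set N : ℕ := max N₁ N₂ with hN
  refine ⟨4 + (N : ℝ) ^ α, by positivity, ?_⟩
  intro Ω₀ _ P₀ _ ξ ζ ψ hξ _ hψ hξnd hψnd Ω _ P _ n W b hW hnorm hb _ v hv hvW hvb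
  -- A unit vector exists, so `n` is positive; the right-hand side vanishes for `n = 0`.
  have hn0 : 0 < n := by
    rcases Nat.eq_zero_or_pos n with rfl | h
    · obtain ⟨ω, hω⟩ := hvW.exists
      have : v ω = 0 := Subsingleton.elim _ _
      rw [this, norm_zero] at hω
      exact absurd hω.1 zero_ne_one
    · exact h
  have hn' : (0 : ℝ) < n := by exact_mod_cast hn0
  have hq0 : 0 < (n : ℝ) ^ (-α) := by positivity
  have hNα : 0 ≤ (N : ℝ) ^ α := by positivity
  have hEpos : 0 < P.real (normEvent W M) := by linarith
  have hE0 : P (normEvent W M) ≠ 0 := fun h => by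
    rw [measureReal_def, h] at hEpos; simp at hEpos
  rcases lt_or_ge n N with hnN | hnN
  -- For bounded `n` the constant makes the bound trivial.
  · have : IsProbabilityMeasure (P[|normEvent W M]) := cond_isProbabilityMeasure hE0
    refine measureReal_le_one.trans ?_
    calc (1 : ℝ) = (n : ℝ) ^ α * (n : ℝ) ^ (-α) := by
          rw [← Real.rpow_add hn']; simp
      _ ≤ (N : ℝ) ^ α * (n : ℝ) ^ (-α) := by gcongr
      _ ≤ _ := by nlinarith
  have hpξ : IsProbabilityMeasure (P₀.map ξ) := Measure.isProbabilityMeasure_map hξ.aemeasurable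
  have hpψ : IsProbabilityMeasure (P₀.map ψ) := Measure.isProbabilityMeasure_map hψ.aemeasurable
  have h1 := hstruct P P₀ n W ξ ζ (hξnd.hasSpread hξ) hW ((le_max_left _ _).trans hnN)
  have h2 := measureReal_inner_eq_zero_le_of_indepFun hv hb.measurable hvb hq0.le
  obtain ⟨r, hr⟩ := hsmall n ((le_max_right _ _).trans hnN)
  have hgood : ∀ (y : EuclideanSpace ℝ (Fin n)) (I : Finset (Fin n)),
      FarFromLattice I η ((n : ℝ) ^ e) ((n ^ A : ℕ) : ℝ) (fun i => y i) →
      P.real {ω | inner ℝ y (b ω) = 0} ≤ (n : ℝ) ^ (-α) := by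
    intro y I hI
    have hbm := hb.measurable
    have h3 := measureReal_sum_eq_zero_le P (fun i ω => b ω i) (fun i => by fun_prop) hb.indep
      (P₀.map ψ) (fun i => (hb.identDistrib i).map_eq) I (fun i => y i) r
    refine le_trans (le_of_eq ?_) (h3.trans (hr _ (hψnd.hasSpread hψ) I _ hI))
    congr 1
    ext ω
    simp only [Set.mem_ofPred_eq, PiLp.inner_apply]
    simp [mul_comm]
  set Z : Set Ω := {ω | inner ℝ (v ω) (b ω) = 0} with hZ
  have hZm : MeasurableSet Z := by
    have hbm := hb.measurable
    have : Measurable fun ω => inner ℝ (v ω) (b ω) := by fun_prop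
    exact this (measurableSet_singleton 0)
  set S₁ : Set Ω := {ω | P.real {ω' | inner ℝ (v ω) (b ω') = 0} ≤ (n : ℝ) ^ (-α) ∧
    inner ℝ (v ω) (b ω) = 0} with hS₁
  set S₂ : Set Ω := {ω | (∀ x : Fin n → ℝ,
      ∑ j, (W ω).mulVec x j ^ 2 ≤ M ^ 2 * n * ∑ i, x i ^ 2) ∧
    ∃ v : Fin n → ℝ, (∑ i, v i ^ 2 = 1 ∧
      ∀ I, ¬ FarFromLattice I η ((n : ℝ) ^ e) ((n ^ A : ℕ) : ℝ) v) ∧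
      ∃ lam : ℝ, ∀ j, (W ω).mulVec v j = lam * v j} with hS₂
  have hle : P.real (normEvent W M ∩ Z) ≤ P.real (S₁ ∪ S₂) := by
    refine ENNReal.toReal_mono (measure_ne_top _ _) (measure_mono_ae ?_)
    filter_upwards [hvW] with ω ⟨hω1, lam, hω2⟩ hωZ
    -- An eigenvector that is orthogonal to `b` with too high a probability is structured.
    by_cases hfar : P.real {ω' | inner ℝ (v ω) (b ω') = 0} ≤ (n : ℝ) ^ (-α)
    · exact Or.inl ⟨hfar, hωZ.2⟩
    · refine Or.inr ⟨sum_sq_mulVec_le_of_norm_le hωZ.1, fun i => v ω i, ⟨?_, fun I hI =>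
        hfar (hgood _ I hI)⟩, lam, fun j => ?_⟩
      · have := EuclideanSpace.norm_sq_eq (v ω)
        rw [hω1] at this
        simpa using this.symm
      · have := congrArg (fun x : EuclideanSpace ℝ (Fin n) => x j) hω2.apply_eq_smul
        simpa [Matrix.toLpLin_apply] using this
  have hsum : P.real (normEvent W M ∩ Z) ≤ 2 * (n : ℝ) ^ (-α) := by
    have := hle.trans (measureReal_union_le S₁ S₂)
    linarith
  have hcond : (P[|normEvent W M]).real Z =
      (P.real (normEvent W M))⁻¹ * P.real (normEvent W M ∩ Z) := by
    rw [measureReal_def, cond_apply' hZm, ENNReal.toReal_mul, ENNReal.toReal_inv]; rfl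
  rw [hcond]
  calc (P.real (normEvent W M))⁻¹ * P.real (normEvent W M ∩ Z)
      ≤ 2 * (2 * (n : ℝ) ^ (-α)) := by
        gcongr
        rw [inv_le_comm₀ hEpos two_pos]; linarith
    _ ≤ _ := by nlinarith
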